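/- Let $A = S^1 \times [0,1]$, $S^1 = \mathbb{R}/\mathbb{Z}$, with coordinates $(\theta, s)$ and area form $\omega = d\theta \wedge ds$, and let $L = \{0\} \times [0,1]$. Hamiltonian vector fields are defined by $\iota_X \omega = dH$, that is $\dot\theta = \partial H/\partial s$, $\dot s = -\partial H/\partial\theta$. Let $\mathrm{Ham}'(A)$ be the set of time-one maps of the flows of smooth Hamiltonians $H_t : A \to \mathbb{R}$, $t \in [0,1]$, that are locally constant near $\partial A$ (on a neighbourhood of $\partial A$ independent of $t$). If $H_t$ is such a Hamiltonian, with time-one map $g$, put $$\mathrm{flux}_L(g) = \int_0^1 H_t(0,1)\,dt - \int_0^1 H_t(0,0)\,dt .$$ For a flow $\phi$ on $A$ the rotation number of $x \in A$ is $r_A(x) = \lim_{t \to +\infty} (\tilde\theta(t) - \tilde\theta(0))/t$, where $\tilde\theta : \mathbb{R} \to \mathbb{R}$ is a continuous lift of the $S^1$-coordinate of $t \mapsto \phi^t(x)$. A loop of fixed points of $\phi^1$ is a closed trajectory of $\phi$ whose least period $T > 0$ satisfies $1/T \in \mathbb{N}$. Then: 1. $\mathrm{flux}_L(g)$ is well defined: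 it depends only on $g \in \mathrm{Ham}'(A)$, not on the Hamiltonian $H_t$ that generates $g$. 2. Let $g$ be the time-one map of the flow of an autonomous Hamiltonian that is smooth and locally constant near $\partial A$. Then the rotation number $r_A(x)$ exists for every $x \in A$ and depends only on $g$ (not on the choice of such an autonomous flow with time-one map $g$); the function $r_A : A \to \mathbb{R}$ is continuous and vanishes near $\partial A$; and $$\mathrm{flux}_L(g) = \int_A r_A\, \omega .$$ 3. The family $\mathcal{M} = \{ g \in \mathrm{Ham}'(A) : \mathrm{flux}_L(g) > 1 \}$ has the fixed loop property detectable by $L$ ($\mathcal{F}_L$ property): whenever $g \in \mathcal{M}$ is the time-one map of the flow $\phi$ of a smooth autonomous Hamiltonian on $A$ that is constant on each component of $\partial A$ (i.e. $\phi$ is tangent to $\partial A$), there is a loop of fixed points of $\phi^1$ that intersects $L$. -/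

import Mathlib

open Set Filter Topology MeasureTheory
open scoped ContDiff

noncomputable section

/-- The annulus `A = S¹ × [0, 1]`, `S¹ = ℝ / ℤ`, with coordinates `(θ, s)`. The measure of the area
form `ω = dθ ∧ ds` is the product measure `volume`, of total mass `1`. -/
abbrev Annulus : Type := UnitAddCircle × unitInterval

/-- The universal covering `ℝ × [0, 1] → A`. -/
def annulusCover (z : ℝ × unitInterval) : Annulus := ((z.1 : UnitAddCircle), z.2)

/-- A function on the annulus in the real coordinates `(θ, s)`. Only its values for `s ∈ [0, 1]`
matter. -/
def inCoords (F : Annulus → ℝ) (θ s : ℝ) : ℝ :=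
  F ((θ : UnitAddCircle), projIcc 0 1 zero_le_one s)

/-- `∂F/∂θ` (one-periodic in `θ`), at a point of the universal cover. -/
def partialTheta (F : Annulus → ℝ) (z : ℝ × unitInterval) : ℝ :=
  deriv (fun θ : ℝ => inCoords F θ z.2) z.1

/-- `∂F/∂s` (one-sided on the boundary), at a point of the universal cover. -/
def partialS (F : Annulus → ℝ) (z : ℝ × unitInterval) : ℝ :=
  derivWithin (fun s : ℝ => inCoords F z.1 s) (Icc 0 1) z.2

/-- `C^∞` functions on the annulus, up to the boundary. -/
def SmoothOnAnnulus (F : Annulus → ℝ) : Prop :=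
  ContDiffOn ℝ ∞ (fun p : ℝ × ℝ => inCoords F p.1 p.2) (univ ×ˢ Icc 0 1)

/-- Time-dependent functions `H_t`, `t ∈ [0, 1]`, that are `C^∞` on `[0, 1] × A`. -/
def SmoothFamilyOnAnnulus (H : ℝ → Annulus → ℝ) : Prop :=
  ContDiffOn ℝ ∞ (fun p : ℝ × ℝ × ℝ => inCoords (H p.1) p.2.1 p.2.2)
    (Icc 0 1 ×ˢ univ ×ˢ Icc 0 1)

/-- A curve in the universal cover that solves Hamilton's equations on the time interval `J`. The
convention is `ι_X ω = dH`, that is `θ' = ∂H/∂s` and `s' = -∂H/∂θ`. -/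
def IsHamiltonianTrajectory (J : Set ℝ) (H : ℝ → Annulus → ℝ) (γ : ℝ → ℝ × unitInterval) : Prop :=
  ∀ t ∈ J,
    HasDerivWithinAt (fun τ : ℝ => (γ τ).1) (partialS (H t) (γ t)) J t ∧
    HasDerivWithinAt (fun τ : ℝ => ((γ τ).2 : ℝ)) (-partialTheta (H t) (γ t)) J t

/-- `φ` is the Hamiltonian flow of `H` for times in `J`: it starts at the identity, and every path
`t ↦ φ t x` lifts to a solution of Hamilton's equations. -/
def IsHamiltonianFlow (J : Set ℝ) (H : ℝ → Annulus → ℝ) (φ : ℝ → Annulus → Annulus) : Prop :=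
  (∀ x, φ 0 x = x) ∧
  ∀ x, ∃ γ : ℝ → ℝ × unitInterval,
    IsHamiltonianTrajectory J H γ ∧ ∀ t ∈ J, annulusCover (γ t) = φ t x

/-- `F` is constant near each of the two components of the boundary, on a collar of width `ε`. -/
def ConstOnCollars (ε : ℝ) (F : Annulus → ℝ) : Prop :=
  (∀ x y : Annulus, (x.2 : ℝ) < ε → (y.2 : ℝ) < ε → F x = F y) ∧
  (∀ x y : Annulus, 1 - ε < (x.2 : ℝ) → 1 - ε < (y.2 : ℝ) → F x = F y)

/-- `H` is a smooth time-dependent Hamiltonian, locally constant near the boundary, and its flow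
on `[0, 1]` has time-one map `g`. -/
def GeneratesStationary (H : ℝ → Annulus → ℝ) (g : Annulus → Annulus) : Prop :=
  SmoothFamilyOnAnnulus H ∧
  (∃ ε > 0, ∀ t ∈ Icc (0 : ℝ) 1, ConstOnCollars ε (H t)) ∧
  ∃ φ : ℝ → Annulus → Annulus, IsHamiltonianFlow (Icc 0 1) H φ ∧ φ 1 = g

/-- `Ham'(A)`: time-one maps of Hamiltonians that are locally constant near the boundary. -/
def HamStationary : Set (Annulus → Annulus) := {g | ∃ H, GeneratesStationary H g}

/-- The flux through `{0} × [0, 1]` of the isotopy generated by `H`. -/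
def hamiltonianFlux (H : ℝ → Annulus → ℝ) : ℝ :=
  (∫ t in (0 : ℝ)..1, H t (0, 1)) - ∫ t in (0 : ℝ)..1, H t (0, 0)

open Classical in
/-- The flux of `g ∈ Ham'(A)`, computed with some Hamiltonian that generates `g`; that all of
them give the same value is a part of the theorem. -/
def fluxL (g : Annulus → Annulus) : ℝ :=
  if h : g ∈ HamStationary then hamiltonianFlux h.choose else 0

/-- `φ` is the flow, for all times, of the smooth autonomous Hamiltonian `F`, and is tangent to the
boundary (`F` is constant on each boundary circle). -/
def IsAutonomousFlow (F : Annulus → ℝ) (φ : ℝ → Annulus → Annulus) : Prop :=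
  SmoothOnAnnulus F ∧
  (∀ θ : UnitAddCircle, F (θ, 0) = F (0, 0) ∧ F (θ, 1) = F (0, 1)) ∧
  IsHamiltonianFlow univ (fun _ => F) φ

/-- An autonomous flow in `Ham'(A)`: its Hamiltonian is locally constant near the boundary. -/
def IsStationaryAutonomousFlow (F : Annulus → ℝ) (φ : ℝ → Annulus → Annulus) : Prop :=
  IsAutonomousFlow F φ ∧ ∃ ε > 0, ConstOnCollars ε F

/-- The path `t ↦ φ t x` has rotation number `r` with respect to the `S¹` coordinate. -/
def HasRotationNumber (φ : ℝ → Annulus → Annulus) (x : Annulus) (r : ℝ) : Prop :=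
  ∃ γ : ℝ → ℝ, Continuous γ ∧ (∀ t, (γ t : UnitAddCircle) = (φ t x).1) ∧
    Tendsto (fun t : ℝ => (γ t - γ 0) / t) atTop (𝓝 r)

/-- `c` is a closed trajectory of `φ`, of least period `T > 0`, such that `1 / T` is an integer;
so all its points are fixed by `φ 1`. -/
def IsLoopOfFixedPoints (φ : ℝ → Annulus → Annulus) (c : Set Annulus) : Prop :=
  ∃ (x : Annulus) (T : ℝ), c = range (fun t => φ t x) ∧
    0 < T ∧ φ T x = x ∧ (∀ t, 0 < t → t < T → φ t x ≠ x) ∧ ∃ n : ℕ, 1 / T = n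

/-- The property `F_L` of a family `M`: for every autonomous `g ∈ M`, and every autonomous flow
with time-one map `g`, there is a loop of fixed points that meets `L`. -/
def FixedLoopProperty (L : Set Annulus) (M : Set (Annulus → Annulus)) : Prop :=
  ∀ g ∈ M, ∀ (F : Annulus → ℝ) (φ : ℝ → Annulus → Annulus), IsAutonomousFlow F φ → φ 1 = g →
    ∃ c, IsLoopOfFixedPoints φ c ∧ (c ∩ L).Nonempty

/-- The curve `L = {0} × [0, 1]`. -/
def radialArc : Set Annulus := {x | x.1 = 0}

end

/-! Everything is lifted to the strip `ℝ × [0, 1]`; write `P = ∂H/∂θ` and `Q = ∂H/∂s`.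

Flux. Let the lifted isotopy carry the arc `L`. The area `∫ θ ds` to the left of the moving arc
changes at the rate `∫ (Q ds - θ dP) = ∫ (Q ds + P dθ) = H_t(0, 1) - H_t(0, 0)`, because `P`
vanishes at both ends. So the flux is the area swept by `L`, and it depends only on the lift of the
time-one map. Polygons inscribed in the arc make this rigorous with Lipschitz dependence on initial
conditions alone (`abs_trapezoidSum_sub_hamiltonianFlux_le`). If the Hamiltonian is constant near
the boundary, the lift fixes `(0, 0)`, so `g` determines it.

Rotation numbers. The energy is conserved, and near a noncritical point two points of equal energy
lie on one short trajectory (`exists_flow_box`). Hence a trajectory that keeps returning to places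
where `Q` is bounded away from zero is closed; otherwise `Q` tends to zero along it and it has
rotation number 0. If a closed trajectory winds around the annulus at all, its lift contains its own
translate by one (`exists_map_eq_shift_one`, by Poincaré-Miranda). So a nonzero rotation number is
`1 / T`, where `T`, of either sign, is the time of one turn. Continuity follows from the flow box
where the number is nonzero, and from compactness of the turning times where it is zero.

Mean. By Liouville's theorem the mean displacement in `θ` is additive in time. Long times show that
its rate is the mean rotation number, short times that it is the mean of `Q`, which equals `F(0, 1)
- F(0, 0)`, the flux.

Fixed loops. The flow `φ` may rotate the boundary, but its time-one map fixes it, so the lift of `φ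
1` moves `(0, 0)` by an integer `k`, the rotation number there. If `k ≠ 0`, the boundary circle is
the loop. If `k = 0`, this lift is the one coming from the stationary isotopy, so the rotation
number has mean equal to the flux, larger than 1, and it vanishes at `(0, 0)`. By continuity it
takes the value 1, which means one turn in time one. -/

/-! ### The strip and the partial derivatives of Hamiltonians -/

/-- The universal cover of the annulus. -/
abbrev Strip : Type := ℝ × unitInterval

/-- The translation of the strip by `a` in the direction of `θ`. -/
def Strip.shift (a : ℝ) (z : Strip) : Strip := (z.1 + a, z.2)

@[simp] theorem Strip.shift_fst (a : ℝ) (z : Strip) : (z.shift a).1 = z.1 + a := rfl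

@[simp] theorem Strip.shift_snd (a : ℝ) (z : Strip) : (z.shift a).2 = z.2 := rfl

theorem Strip.shift_shift (a b : ℝ) (z : Strip) : (z.shift a).shift b = z.shift (a + b) :=
  Prod.ext (add_assoc _ _ _) rfl

@[simp] theorem Strip.shift_zero (z : Strip) : z.shift 0 = z :=
  Prod.ext (add_zero _) rfl

theorem Strip.dist_eq (z w : Strip) : dist z w = max |z.1 - w.1| |(z.2 : ℝ) - w.2| := by
  rw [Prod.dist_eq, Real.dist_eq, Subtype.dist_eq, Real.dist_eq]

/-- `F` is differentiable on the strip with partial derivatives `P = ∂F/∂θ` and `Q = ∂F/∂s`, which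
are periodic, bounded, and Lipschitz, and `F` is constant along the boundary. -/
structure IsStripGradient (K : NNReal) (F P Q : Strip → ℝ) : Prop where
  lipschitz_theta : LipschitzWith K P
  lipschitz_s : LipschitzWith K Q
  abs_theta_le : ∀ z, |P z| ≤ K
  abs_s_le : ∀ z, |Q z| ≤ K
  -- The base point `p` is independent of the segment from `z` to `w`. Taken at the endpoints, it
  -- gives the trapezoid rule; at a nearby point, the injectivity on transversals in `eq_of_level`.
  taylor : ∀ p z w : Strip, |F w - F z - P p * (w.1 - z.1) - Q p * ((w.2 : ℝ) - z.2)| ≤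
    K * (dist w p + dist z p) * dist w z
  shift_eq : ∀ (n : ℤ) z, F (z.shift n) = F z
  theta_shift : ∀ (n : ℤ) z, P (z.shift n) = P z
  s_shift : ∀ (n : ℤ) z, Q (z.shift n) = Q z
  theta_bot : ∀ θ, P (θ, 0) = 0
  theta_top : ∀ θ, P (θ, 1) = 0

theorem inCoords_add_intCast (F : Annulus → ℝ) (θ s : ℝ) (n : ℤ) :
    inCoords F (θ + n) s = inCoords F θ s := by
  have : ((θ + n : ℝ) : UnitAddCircle) = θ := by
    rw [AddCircle.coe_add, add_eq_left, AddCircle.coe_eq_zero_iff]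
    exact ⟨n, by simp⟩
  simp only [inCoords, this]

theorem annulusCover_shift (n : ℤ) (z : Strip) : annulusCover (z.shift n) = annulusCover z := by
  have : ((z.1 + n : ℝ) : UnitAddCircle) = z.1 := by
    rw [AddCircle.coe_add, add_eq_left, AddCircle.coe_eq_zero_iff]
    exact ⟨n, by simp⟩
  simp only [annulusCover, Strip.shift_fst, Strip.shift_snd, this]

theorem inCoords_coe (F : Annulus → ℝ) (z : Strip) :
    inCoords F z.1 z.2 = F (annulusCover z) := by
  simp [inCoords, annulusCover, projIcc_val]

theorem partialTheta_shift (F : Annulus → ℝ) (n : ℤ) (z : Strip) :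
    partialTheta F (z.shift n) = partialTheta F z := by
  simp only [partialTheta, Strip.shift_fst, Strip.shift_snd]
  rw [← deriv_comp_add_const]
  simp only [inCoords_add_intCast]

theorem partialS_shift (F : Annulus → ℝ) (n : ℤ) (z : Strip) :
    partialS F (z.shift n) = partialS F z := by
  simp only [partialS, Strip.shift_fst, Strip.shift_snd, inCoords_add_intCast]

/-- A continuous function on `[0, 1] × ℝ × [0, 1]` that is one-periodic in the second variable is
bounded. -/
theorem exists_norm_le_of_periodic {E : Type*} [NormedAddCommGroup E] {f : ℝ × ℝ × ℝ → E}
    (hf : ContinuousOn f (Icc 0 1 ×ˢ univ ×ˢ Icc 0 1))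
    (hper : ∀ (n : ℤ) (p : ℝ × ℝ × ℝ), f (p + (0, (n : ℝ), 0)) = f p) :
    ∃ C, ∀ p ∈ (Icc 0 1 ×ˢ univ ×ˢ Icc 0 1 : Set (ℝ × ℝ × ℝ)), ‖f p‖ ≤ C := by
  have hc : IsCompact (Icc 0 1 ×ˢ Icc 0 1 ×ˢ Icc 0 1 : Set (ℝ × ℝ × ℝ)) :=
    isCompact_Icc.prod (isCompact_Icc.prod isCompact_Icc)
  obtain ⟨C, hC⟩ := hc.exists_bound_of_continuousOn
    (hf.mono (prod_mono_right (prod_mono_left (subset_univ _))))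
  refine ⟨C, fun p hp => ?_⟩
  rw [← hper (-⌊p.2.1⌋) p]
  refine hC _ ⟨by simpa using hp.1, ?_, by simpa using hp.2.2⟩
  have h1 := Int.floor_le p.2.1
  have h2 := Int.lt_floor_add_one p.2.1
  constructor <;> simp <;> linarith

theorem uniqueDiffOn_timeStrip :
    UniqueDiffOn ℝ (Icc 0 1 ×ˢ univ ×ˢ Icc 0 1 : Set (ℝ × ℝ × ℝ)) :=
  (uniqueDiffOn_Icc zero_lt_one).prod (uniqueDiffOn_univ.prod (uniqueDiffOn_Icc zero_lt_one))

open scoped Pointwise in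
theorem fderivWithin_timeStrip_periodic {E : Type*} [NormedAddCommGroup E] [NormedSpace ℝ E]
    {f : ℝ × ℝ × ℝ → E} (hper : ∀ (n : ℤ) (p : ℝ × ℝ × ℝ), f (p + (0, (n : ℝ), 0)) = f p)
    (n : ℤ) (p : ℝ × ℝ × ℝ) :
    fderivWithin ℝ f (Icc 0 1 ×ˢ univ ×ˢ Icc 0 1) (p + (0, (n : ℝ), 0)) =
      fderivWithin ℝ f (Icc 0 1 ×ˢ univ ×ˢ Icc 0 1) p := by
  have h := fderivWithin_comp_add_right (𝕜 := ℝ) (f := f) (s := Icc 0 1 ×ˢ univ ×ˢ Icc 0 1) (x := p)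
    (0, (n : ℝ), 0)
  have hs : ((0, (n : ℝ), 0) : ℝ × ℝ × ℝ) +ᵥ (Icc 0 1 ×ˢ univ ×ˢ Icc 0 1 : Set (ℝ × ℝ × ℝ)) =
      Icc 0 1 ×ˢ univ ×ˢ Icc 0 1 := by
    ext q
    rw [mem_vadd_set_iff_neg_vadd_mem]
    simp [mem_prod]
  rw [hs] at h
  rw [← h]
  simp only [hper]

/-- The partial derivatives of a smooth family of Hamiltonians that are constant on the boundary
circles, with bounds that are uniform in time. -/
theorem SmoothFamilyOnAnnulus.exists_isStripGradient {H : ℝ → Annulus → ℝ}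
    (hH : SmoothFamilyOnAnnulus H)
    (hb : ∀ t ∈ Icc (0 : ℝ) 1, ∀ θ : UnitAddCircle,
      H t (θ, 0) = H t (0, 0) ∧ H t (θ, 1) = H t (0, 1)) :
    ∃ K, ∀ t ∈ Icc (0 : ℝ) 1,
      IsStripGradient K (H t ∘ annulusCover) (partialTheta (H t)) (partialS (H t)) := by
  set W : Set (ℝ × ℝ × ℝ) := Icc 0 1 ×ˢ univ ×ˢ Icc 0 1 with hW
  set G : ℝ × ℝ × ℝ → ℝ := fun p => inCoords (H p.1) p.2.1 p.2.2 with hG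
  have hGs : ContDiffOn ℝ ∞ G W := hH
  have hu : UniqueDiffOn ℝ W := uniqueDiffOn_timeStrip
  have hconv : Convex ℝ W := (convex_Icc 0 1).prod (convex_univ.prod (convex_Icc 0 1))
  have hGper : ∀ (n : ℤ) (p : ℝ × ℝ × ℝ), G (p + (0, (n : ℝ), 0)) = G p := fun n p => by
    simp [hG, inCoords_add_intCast]
  set D := fderivWithin ℝ G W with hD
  have hDs : ContDiffOn ℝ ∞ D W := hGs.fderivWithin hu (by simp)
  have hDper : ∀ (n : ℤ) (p : ℝ × ℝ × ℝ), D (p + (0, (n : ℝ), 0)) = D p :=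
    fderivWithin_timeStrip_periodic hGper
  have hD2s : ContDiffOn ℝ ∞ (fderivWithin ℝ D W) W := hDs.fderivWithin hu (by simp)
  obtain ⟨C₁, hC₁⟩ := exists_norm_le_of_periodic hDs.continuousOn hDper
  obtain ⟨C₂, hC₂⟩ := exists_norm_le_of_periodic hD2s.continuousOn
    (fderivWithin_timeStrip_periodic hDper)
  set K : NNReal := Real.toNNReal (max C₁ C₂)
  have hK1 : ∀ p ∈ W, ‖D p‖ ≤ K := fun p hp =>
    (hC₁ p hp).trans ((le_max_left _ _).trans (Real.le_coe_toNNReal _))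
  have hK2 : ∀ p ∈ W, ‖fderivWithin ℝ D W p‖ ≤ K := fun p hp =>
    (hC₂ p hp).trans ((le_max_right _ _).trans (Real.le_coe_toNNReal _))
  have hlip : LipschitzOnWith K D W :=
    hconv.lipschitzOnWith_of_nnnorm_fderivWithin_le (hDs.differentiableOn (by simp)) hK2
  refine ⟨K, fun t ht => ?_⟩
  have hmem : ∀ z : Strip, ((t, z.1, (z.2 : ℝ)) : ℝ × ℝ × ℝ) ∈ W := fun z =>
    ⟨ht, mem_univ _, z.2.2⟩
  have hder : ∀ p ∈ W, HasFDerivWithinAt G (D p) W p := fun p hp =>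
    ((hGs.differentiableOn (by simp)) p hp).hasFDerivWithinAt
  have hP : ∀ z : Strip, partialTheta (H t) z = D (t, z.1, z.2) (0, 1, 0) := fun z => by
    have h1 : HasDerivWithinAt (fun θ : ℝ => ((t, θ, (z.2 : ℝ)) : ℝ × ℝ × ℝ)) (0, 1, 0) univ z.1 :=
      (hasDerivWithinAt_const _ _ _).prodMk
        ((hasDerivWithinAt_id _ _).prodMk (hasDerivWithinAt_const _ _ _))
    have h2 := (hder _ (hmem z)).comp_hasDerivWithinAt z.1 h1 (fun θ _ => hmem (θ, z.2))
    rw [hasDerivWithinAt_univ] at h2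
    exact h2.deriv
  have hQ : ∀ z : Strip, partialS (H t) z = D (t, z.1, z.2) (0, 0, 1) := fun z => by
    have h1 : HasDerivWithinAt (fun s : ℝ => ((t, z.1, s) : ℝ × ℝ × ℝ)) (0, 0, 1) (Icc 0 1) z.2 :=
      (hasDerivWithinAt_const _ _ _).prodMk
        ((hasDerivWithinAt_const _ _ _).prodMk (hasDerivWithinAt_id _ _))
    have h2 := (hder _ (hmem z)).comp_hasDerivWithinAt (z.2 : ℝ) h1
      (fun s hs => hmem (z.1, ⟨s, hs⟩))
    exact h2.derivWithin (uniqueDiffOn_Icc zero_lt_one _ z.2.2)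
  have hdist : ∀ z w : Strip, dist ((t, z.1, (z.2 : ℝ)) : ℝ × ℝ × ℝ) (t, w.1, (w.2 : ℝ)) =
      dist z w := fun z w => by
    rw [Prod.dist_eq, dist_self, max_eq_right dist_nonneg, Prod.dist_eq, Prod.dist_eq]
    rfl
  have happ : ∀ (L : ℝ × ℝ × ℝ →L[ℝ] ℝ) (v : ℝ × ℝ × ℝ), ‖v‖ ≤ 1 → |L v| ≤ ‖L‖ := fun L v hv =>
    (L.le_opNorm v).trans (mul_le_of_le_one_right (norm_nonneg _) hv)
  have hv1 : ‖((0, 1, 0) : ℝ × ℝ × ℝ)‖ ≤ 1 := by simp [Prod.norm_def]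
  have hv2 : ‖((0, 0, 1) : ℝ × ℝ × ℝ)‖ ≤ 1 := by simp [Prod.norm_def]
  have hlip' : ∀ v : ℝ × ℝ × ℝ, ‖v‖ ≤ 1 →
      LipschitzWith K (fun z : Strip => D (t, z.1, z.2) v) := fun v hv =>
    LipschitzWith.of_dist_le_mul fun z w => by
      rw [Real.dist_eq, ← sub_apply]
      refine (happ _ _ hv).trans ?_
      rw [← dist_eq_norm, ← hdist z w]
      exact hlip.dist_le_mul _ (hmem z) _ (hmem w)
  refine ⟨?_, ?_, ?_, ?_, ?_, ?_, partialTheta_shift _, partialS_shift _, ?_, ?_⟩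
  · simpa only [← hP] using hlip' _ hv1
  · simpa only [← hQ] using hlip' _ hv2
  · exact fun z => (hP z).symm ▸ (happ _ _ hv1).trans (hK1 _ (hmem z))
  · exact fun z => (hQ z).symm ▸ (happ _ _ hv2).trans (hK1 _ (hmem z))
  · intro p z w
    -- Both endpoints lie in the ball of radius `R` about `p`, hence so does the segment, and on it
    -- the differential is within `K * R` of its value at `p`.
    set R := dist w p + dist z p
    have hs : Convex ℝ (W ∩ Metric.closedBall (t, p.1, (p.2 : ℝ)) R) :=
      hconv.inter (convex_closedBall _ _)
    have key := hs.norm_image_sub_le_of_norm_hasFDerivWithin_le' (f := G) (f' := D)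
      (φ := D (t, p.1, p.2)) (C := K * R) (x := (t, z.1, (z.2 : ℝ))) (y := (t, w.1, (w.2 : ℝ)))
      (fun x hx => (hder x hx.1).mono inter_subset_left)
      (fun x hx => by
        rw [← dist_eq_norm]
        exact (hlip.dist_le_mul _ hx.1 _ (hmem p)).trans
          (mul_le_mul_of_nonneg_left hx.2 K.2))
      ⟨hmem z, by rw [Metric.mem_closedBall, hdist]; exact le_add_of_nonneg_left dist_nonneg⟩
      ⟨hmem w, by rw [Metric.mem_closedBall, hdist]; exact le_add_of_nonneg_right dist_nonneg⟩
    rw [← dist_eq_norm (t, w.1, (w.2 : ℝ)), hdist] at key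
    have hlin : D (t, p.1, p.2) ((t, w.1, (w.2 : ℝ)) - (t, z.1, (z.2 : ℝ))) =
        partialTheta (H t) p * (w.1 - z.1) + partialS (H t) p * ((w.2 : ℝ) - z.2) := by
      have : ((t, w.1, (w.2 : ℝ)) - (t, z.1, (z.2 : ℝ)) : ℝ × ℝ × ℝ) =
          (w.1 - z.1) • (0, 1, 0) + ((w.2 : ℝ) - z.2) • (0, 0, 1) := by
        ext <;> simp
      rw [this, map_add, map_smul, map_smul, hP, hQ, smul_eq_mul, smul_eq_mul]
      ring
    rw [hlin, Real.norm_eq_abs] at key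
    simp only [hG, inCoords_coe] at key
    refine le_trans (le_of_eq ?_) key
    simp only [Function.comp_apply]
    congr 1
    ring
  · exact fun n z => by simp only [Function.comp_apply, annulusCover_shift]
  · intro θ
    have : (fun θ : ℝ => inCoords (H t) θ ((0 : unitInterval) : ℝ)) = fun _ => H t (0, 0) := by
      ext θ
      rw [inCoords_coe (H t) (θ, 0)]
      exact (hb t ht _).1
    simp only [partialTheta, this, deriv_const]
  · intro θ
    have : (fun θ : ℝ => inCoords (H t) θ ((1 : unitInterval) : ℝ)) = fun _ => H t (0, 1) := by
      ext θ
      rw [inCoords_coe (H t) (θ, 1)]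
      exact (hb t ht _).2
    simp only [partialTheta, this, deriv_const]

/-! ### Solutions in the strip and their lifts -/

/-- Solutions on `J` of `θ' = Q`, `s' = -P` in the strip. -/
def IsStripSolution (J : Set ℝ) (P Q : ℝ → Strip → ℝ) (γ : ℝ → Strip) : Prop :=
  ∀ t ∈ J, HasDerivWithinAt (fun τ : ℝ => (γ τ).1) (Q t (γ t)) J t ∧
    HasDerivWithinAt (fun τ : ℝ => ((γ τ).2 : ℝ)) (-P t (γ t)) J t

theorem IsHamiltonianTrajectory.isStripSolution {J : Set ℝ} {H : ℝ → Annulus → ℝ}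
    {γ : ℝ → Strip} (h : IsHamiltonianTrajectory J H γ) :
    IsStripSolution J (fun t => partialTheta (H t)) (fun t => partialS (H t)) γ := h

theorem IsStripSolution.mono {J J' : Set ℝ} {P Q : ℝ → Strip → ℝ} {γ : ℝ → Strip}
    (h : IsStripSolution J P Q γ) (hJ : J' ⊆ J) : IsStripSolution J' P Q γ :=
  fun t ht => ⟨(h t (hJ ht)).1.mono hJ, (h t (hJ ht)).2.mono hJ⟩

theorem IsStripSolution.continuousOn {J : Set ℝ} {P Q : ℝ → Strip → ℝ} {γ : ℝ → Strip}
    (h : IsStripSolution J P Q γ) : ContinuousOn γ J := by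
  refine ContinuousOn.prodMk (fun t ht => (h t ht).1.continuousWithinAt) ?_
  rw [Topology.IsInducing.subtypeVal.continuousOn_iff]
  exact fun t ht => (h t ht).2.continuousWithinAt

/-- Lipschitz dependence of solutions on the initial condition. -/
theorem IsStripSolution.dist_le {K : NNReal} {P Q : ℝ → Strip → ℝ} {a b : ℝ}
    (hP : ∀ t ∈ Icc a b, LipschitzWith K (P t)) (hQ : ∀ t ∈ Icc a b, LipschitzWith K (Q t))
    {γ δ : ℝ → Strip} (hγ : IsStripSolution (Icc a b) P Q γ)
    (hδ : IsStripSolution (Icc a b) P Q δ) :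
    ∀ t ∈ Icc a b, dist (γ t) (δ t) ≤ dist (γ a) (δ a) * Real.exp (K * (t - a)) := by
  -- Grönwall's inequality is applied in the plane: the retraction `π` onto the strip is
  -- 1-Lipschitz, so it extends the vector field with the same constant.
  set ι : Strip → ℝ × ℝ := fun z => (z.1, z.2) with hι
  set π : ℝ × ℝ → Strip := fun x => (x.1, projIcc 0 1 zero_le_one x.2) with hπ
  have hπι : ∀ z, π (ι z) = z := fun z => by simp [hι, hπ, projIcc_val]
  have hιd : ∀ z w, dist (ι z) (ι w) = dist z w := fun z w => rfl
  have hπl : LipschitzWith 1 π := LipschitzWith.of_dist_le_mul fun x y => by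
    rw [NNReal.coe_one, one_mul, Prod.dist_eq, Prod.dist_eq]
    exact max_le_max le_rfl ((LipschitzWith.projIcc zero_le_one).dist_le_mul x.2 y.2 |>.trans
      (by simp))
  have hι' : ∀ γ : ℝ → Strip, IsStripSolution (Icc a b) P Q γ → ContinuousOn (ι ∘ γ) (Icc a b) ∧
      ∀ t ∈ Ico a b,
        HasDerivWithinAt (ι ∘ γ) (Q t (π (ι (γ t))), -P t (π (ι (γ t)))) (Ici t) t := by
    intro γ hγ
    refine ⟨(continuous_fst.prodMk (continuous_subtype_val.comp continuous_snd)).comp_continuousOn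
      hγ.continuousOn, fun t ht => ?_⟩
    rw [hπι]
    have h := hγ t (Ico_subset_Icc_self ht)
    exact (h.1.prodMk h.2).mono_of_mem_nhdsWithin (Icc_mem_nhdsGE_of_mem ht)
  intro t ht
  have key := dist_le_of_trajectories_ODE_of_mem (K := K) (a := a) (b := b)
    (v := fun t x => (Q t (π x), -P t (π x))) (s := fun _ => univ) (f := ι ∘ γ) (g := ι ∘ δ)
    (δ := dist (γ a) (δ a))
    (fun t ht => LipschitzOnWith.of_dist_le_mul fun x _ y _ => by
      have ht' := Ico_subset_Icc_self ht
      have hπxy : dist (π x) (π y) ≤ dist x y := by simpa using hπl.dist_le_mul x y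
      rw [Prod.dist_eq, dist_neg_neg]
      exact max_le (((hQ t ht').dist_le_mul _ _).trans (mul_le_mul_of_nonneg_left hπxy K.2))
        (((hP t ht').dist_le_mul _ _).trans (mul_le_mul_of_nonneg_left hπxy K.2)))
    (hι' γ hγ).1 (hι' γ hγ).2 (fun _ _ => mem_univ _) (hι' δ hδ).1 (hι' δ hδ).2
    (fun _ _ => mem_univ _) le_rfl t ht
  exact key

/-- A solution that starts on the boundary stays on it. -/
theorem IsStripSolution.eq_of_boundary {K : NNReal} {P Q : ℝ → Strip → ℝ} {a b : ℝ}
    {e : unitInterval}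
    (hP : ∀ t ∈ Icc a b, LipschitzWith K (P t)) (he : ∀ t ∈ Icc a b, ∀ θ, P t (θ, e) = 0)
    {γ : ℝ → Strip} (hγ : IsStripSolution (Icc a b) P Q γ) (h0 : (γ a).2 = e) :
    ∀ t ∈ Icc a b, (γ t).2 = e := by
  intro t ht
  -- `P` is Lipschitz and vanishes at height `e`, so the height satisfies `|s'| ≤ K |s - e|`.
  have key := eq_zero_of_abs_deriv_le_mul_abs_self_of_eq_zero_right (K := K) (a := a) (b := b)
    (f := fun t => ((γ t).2 : ℝ) - e) (f' := fun t => -P t (γ t))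
    (fun t ht => ((hγ t ht).2.sub_const _).continuousWithinAt)
    (fun t ht => ((hγ t (Ico_subset_Icc_self ht)).2.sub_const _).mono_of_mem_nhdsWithin
      (Icc_mem_nhdsGE_of_mem ht)) (by simp [h0])
    (fun t ht => by
      have := (hP t (Ico_subset_Icc_self ht)).dist_le_mul (γ t) ((γ t).1, e)
      rw [he t (Ico_subset_Icc_self ht), dist_zero_right] at this
      rw [norm_neg]
      refine this.trans (le_of_eq ?_)
      rw [Prod.dist_eq, dist_self, max_eq_right dist_nonneg, Subtype.dist_eq, Real.dist_eq,
        Real.norm_eq_abs]) t ht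
  exact Subtype.ext (sub_eq_zero.1 key)

/-- Two continuous lifts to the strip of a map to the annulus agree if they agree at a point. -/
theorem eq_of_annulusCover_eq {A : Type*} [TopologicalSpace A] [PreconnectedSpace A]
    {f g : A → Strip} (hf : Continuous f) (hg : Continuous g)
    (h : ∀ a, annulusCover (f a) = annulusCover (g a)) (a₀ : A) (h₀ : f a₀ = g a₀) : f = g := by
  have h1 := (AddCircle.isCoveringMap_coe (1 : ℝ)).eq_of_comp_eq (g₁ := fun a => (f a).1)
    (g₂ := fun a => (g a).1) (continuous_fst.comp hf) (continuous_fst.comp hg)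
    (funext fun a => (Prod.ext_iff.1 (h a)).1) a₀ (congrArg Prod.fst h₀)
  exact funext fun a => Prod.ext (congrFun h1 a) (Prod.ext_iff.1 (h a)).2

theorem IsStripSolution.shift {J : Set ℝ} {P Q : ℝ → Strip → ℝ} {γ : ℝ → Strip}
    (hγ : IsStripSolution J P Q γ) (n : ℤ) (hP : ∀ t ∈ J, ∀ z, P t (z.shift n) = P t z)
    (hQ : ∀ t ∈ J, ∀ z, Q t (z.shift n) = Q t z) :
    IsStripSolution J P Q (fun t => Strip.shift n (γ t)) := fun t ht => by
  rw [hP t ht, hQ t ht]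
  exact ⟨(hγ t ht).1.add_const _, (hγ t ht).2⟩

theorem exists_shift_of_annulusCover_eq {z w : Strip} (h : annulusCover z = annulusCover w) :
    ∃ n : ℤ, z = w.shift n := by
  obtain ⟨h1, h2⟩ := Prod.ext_iff.1 h
  have h1' : (z.1 : UnitAddCircle) = w.1 := h1
  rw [← sub_eq_zero, ← AddCircle.coe_sub, AddCircle.coe_eq_zero_iff] at h1'
  obtain ⟨n, hn⟩ := h1'
  exact ⟨n, Prod.ext (by simp only [zsmul_eq_mul, mul_one] at hn; simp [hn]) h2⟩

/-- The paths of a Hamiltonian flow lift to solutions with any given initial lift. -/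
theorem IsHamiltonianFlow.exists_lift {J : Set ℝ} {H : ℝ → Annulus → ℝ}
    {φ : ℝ → Annulus → Annulus} (hφ : IsHamiltonianFlow J H φ) (h0 : 0 ∈ J) (z : Strip) :
    ∃ γ : ℝ → Strip,
      IsStripSolution J (fun t => partialTheta (H t)) (fun t => partialS (H t)) γ ∧
      γ 0 = z ∧ ∀ t ∈ J, annulusCover (γ t) = φ t (annulusCover z) := by
  obtain ⟨γ, hγ, hγφ⟩ := hφ.2 (annulusCover z)
  have h := hγφ 0 h0
  rw [hφ.1] at h
  obtain ⟨n, hn⟩ := exists_shift_of_annulusCover_eq h.symm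
  refine ⟨fun t => Strip.shift n (γ t), hγ.isStripSolution.shift n
    (fun t _ => partialTheta_shift _ _) (fun t _ => partialS_shift _ _), hn.symm, fun t ht => ?_⟩
  rw [annulusCover_shift, hγφ t ht]

/-! ### The flux as the area swept by the arc -/

/-- The area to the left of the polygonal path with vertices `c 0, …, c N`. -/
noncomputable def trapezoidSum (N : ℕ) (c : ℕ → Strip) : ℝ :=
  ∑ i ∈ Finset.range N, ((c i).1 + (c (i + 1)).1) / 2 * (((c (i + 1)).2 : ℝ) - (c i).2)

/-- The mean of the Taylor estimates at the two endpoints. The averages of `P` and `Q` are those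
that summation by parts produces, and an error of order two is negligible when summed over `N` edges
of length `O(1 / N)`. -/
theorem IsStripGradient.abs_trapezoid_le {K : NNReal} {F P Q : Strip → ℝ}
    (h : IsStripGradient K F P Q) (z w : Strip) :
    |F w - F z - (P z + P w) / 2 * (w.1 - z.1) - (Q z + Q w) / 2 * ((w.2 : ℝ) - z.2)| ≤
      K * dist w z ^ 2 := by
  have h1 := h.taylor z z w
  have h2 := h.taylor w z w
  rw [dist_self, add_zero] at h1
  rw [dist_self, zero_add, dist_comm z w] at h2
  have e : F w - F z - (P z + P w) / 2 * (w.1 - z.1) - (Q z + Q w) / 2 * ((w.2 : ℝ) - z.2) =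
    ((F w - F z - P z * (w.1 - z.1) - Q z * ((w.2 : ℝ) - z.2)) +
      (F w - F z - P w * (w.1 - z.1) - Q w * ((w.2 : ℝ) - z.2))) / 2 := by ring
  rw [e, abs_div, abs_two]
  have := abs_add_le (F w - F z - P z * (w.1 - z.1) - Q z * ((w.2 : ℝ) - z.2))
    (F w - F z - P w * (w.1 - z.1) - Q w * ((w.2 : ℝ) - z.2))
  nlinarith

/-- The rate of change of the area to the left of a polygonal path that moves with the flow is the
difference of the values of the Hamiltonian at its ends, up to a small error. -/
theorem IsStripGradient.abs_sum_sub_le {K : NNReal} {F P Q : Strip → ℝ}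
    (h : IsStripGradient K F P Q) (N : ℕ) (c : ℕ → Strip) {d : ℝ}
    (hd : ∀ i < N, dist (c (i + 1)) (c i) ≤ d) (h0 : P (c 0) = 0) (hN : P (c N) = 0) :
    |(∑ i ∈ Finset.range N, ((Q (c i) + Q (c (i + 1))) / 2 * (((c (i + 1)).2 : ℝ) - (c i).2) +
      ((c i).1 + (c (i + 1)).1) / 2 * (-P (c (i + 1)) - -P (c i)))) - (F (c N) - F (c 0))| ≤
      N * (K * d ^ 2) := by
  have e1 : F (c N) - F (c 0) = ∑ i ∈ Finset.range N, (F (c (i + 1)) - F (c i)) :=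
    (Finset.sum_range_sub (fun i => F (c i)) N).symm
  -- Summation by parts: the increments of `θ P` add up to zero because `P` vanishes at both ends,
  -- and adding them turns the terms `-θ dP` into `P dθ` exactly.
  have e2 : ∑ i ∈ Finset.range N, ((c (i + 1)).1 * P (c (i + 1)) - (c i).1 * P (c i)) = 0 := by
    rw [Finset.sum_range_sub (fun i => (c i).1 * P (c i)) N, h0, hN]
    ring
  set f : ℕ → ℝ := fun i => (Q (c i) + Q (c (i + 1))) / 2 * (((c (i + 1)).2 : ℝ) - (c i).2) +
    ((c i).1 + (c (i + 1)).1) / 2 * (-P (c (i + 1)) - -P (c i))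
  have hterm : ∀ i ∈ Finset.range N, |f i - (F (c (i + 1)) - F (c i)) +
      ((c (i + 1)).1 * P (c (i + 1)) - (c i).1 * P (c i))| ≤ K * d ^ 2 := by
    intro i hi
    have h1 := h.abs_trapezoid_le (c i) (c (i + 1))
    have h2 : (K : ℝ) * dist (c (i + 1)) (c i) ^ 2 ≤ K * d ^ 2 :=
      mul_le_mul_of_nonneg_left (pow_le_pow_left₀ dist_nonneg (hd i (Finset.mem_range.1 hi)) 2) K.2
    rw [← abs_neg] at h1
    refine le_trans (le_of_eq ?_) (h1.trans h2)
    congr 1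
    simp only [f]
    ring
  have hsum := (Finset.abs_sum_le_sum_abs _ _).trans (Finset.sum_le_sum hterm)
  rw [Finset.sum_add_distrib, e2, add_zero, Finset.sum_sub_distrib, ← e1] at hsum
  simpa using hsum

/-- The subdivision of `{0} × [0, 1]` into `N` equal parts. -/
noncomputable def arcPoint (N i : ℕ) : Strip := (0, projIcc 0 1 zero_le_one ((i : ℝ) / N))

theorem arcPoint_zero (N : ℕ) : arcPoint N 0 = (0, 0) := by
  simp [arcPoint, projIcc_left]

theorem arcPoint_self {N : ℕ} (hN : N ≠ 0) : arcPoint N N = (0, 1) := by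
  simp [arcPoint, hN, projIcc_right]

theorem dist_arcPoint_succ_le (N i : ℕ) : dist (arcPoint N (i + 1)) (arcPoint N i) ≤ 1 / N := by
  rw [arcPoint, arcPoint, Prod.dist_eq, dist_self, max_eq_right dist_nonneg]
  refine ((LipschitzWith.projIcc zero_le_one).dist_le_mul _ _).trans (le_of_eq ?_)
  rw [NNReal.coe_one, one_mul, Real.dist_eq, ← sub_div, Nat.cast_add, Nat.cast_one,
    add_sub_cancel_left, abs_of_nonneg (by positivity)]

theorem SmoothFamilyOnAnnulus.continuousOn_time {H : ℝ → Annulus → ℝ}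
    (hH : SmoothFamilyOnAnnulus H) (z : Strip) :
    ContinuousOn (fun t => H t (annulusCover z)) (Icc 0 1) := by
  have h : ContinuousOn (fun t => inCoords (H t) z.1 z.2) (Icc 0 1) :=
    hH.continuousOn.comp (f := fun t : ℝ => ((t, z.1, (z.2 : ℝ)) : ℝ × ℝ × ℝ))
      (by fun_prop) fun t ht => ⟨ht, mem_univ _, z.2.2⟩
  simpa only [inCoords_coe] using h

/-- The flux of an isotopy is the limit of the areas that the polygonal approximations of the arc
`L` sweep out. -/
theorem abs_trapezoidSum_sub_hamiltonianFlux_le {H : ℝ → Annulus → ℝ} {K : NNReal}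
    (hH : SmoothFamilyOnAnnulus H)
    (hb : ∀ t ∈ Icc (0 : ℝ) 1, ∀ θ : UnitAddCircle,
      H t (θ, 0) = H t (0, 0) ∧ H t (θ, 1) = H t (0, 1))
    (hK : ∀ t ∈ Icc (0 : ℝ) 1,
      IsStripGradient K (H t ∘ annulusCover) (partialTheta (H t)) (partialS (H t)))
    {γ : Strip → ℝ → Strip}
    (hγ : ∀ z, IsStripSolution (Icc 0 1) (fun t => partialTheta (H t))
      (fun t => partialS (H t)) (γ z))
    (h0 : ∀ z, γ z 0 = z) {N : ℕ} (hN : N ≠ 0) :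
    |trapezoidSum N (fun i => γ (arcPoint N i) 1) - hamiltonianFlux H| ≤
      K * Real.exp K ^ 2 / N := by
  have hlipP : ∀ t ∈ Icc (0 : ℝ) 1, LipschitzWith K (partialTheta (H t)) :=
    fun t ht => (hK t ht).lipschitz_theta
  have hlipQ : ∀ t ∈ Icc (0 : ℝ) 1, LipschitzWith K (partialS (H t)) :=
    fun t ht => (hK t ht).lipschitz_s
  set c : ℝ → ℕ → Strip := fun t i => γ (arcPoint N i) t with hc
  -- The edges have length at most `1 / N` at time zero, and the flow stretches distances by at most
  -- `exp K` up to time one.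
  have hd : ∀ t ∈ Icc (0 : ℝ) 1, ∀ i, dist (c t (i + 1)) (c t i) ≤ Real.exp K / N := by
    intro t ht i
    refine ((hγ _).dist_le hlipP hlipQ (hγ _) t ht).trans ?_
    rw [h0, h0, div_eq_mul_one_div, mul_comm (Real.exp _)]
    refine mul_le_mul (dist_arcPoint_succ_le N i) (Real.exp_le_exp.2 ?_) (Real.exp_nonneg _)
      (by positivity)
    rw [sub_zero]
    exact mul_le_of_le_one_right K.2 ht.2
  have hbot : ∀ t ∈ Icc (0 : ℝ) 1, (c t 0).2 = 0 :=
    (hγ _).eq_of_boundary hlipP (fun t ht => (hK t ht).theta_bot) (by rw [h0, arcPoint_zero])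
  have htop : ∀ t ∈ Icc (0 : ℝ) 1, (c t N).2 = 1 :=
    (hγ _).eq_of_boundary hlipP (fun t ht => (hK t ht).theta_top) (by rw [h0, arcPoint_self hN])
  set b : ℝ → ℝ := fun t => H t (0, 1) - H t (0, 0) with hb'
  have hbc : ContinuousOn b (Icc 0 1) := by
    have h1 := hH.continuousOn_time (0, 1)
    have h2 := hH.continuousOn_time (0, 0)
    exact h1.sub h2
  have hflux : hamiltonianFlux H =
      ∫ t in (0 : ℝ)..1, IccExtend zero_le_one (domRestrict (Icc 0 1) b) t := by
    rw [hamiltonianFlux, ← intervalIntegral.integral_sub]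
    · refine intervalIntegral.integral_congr fun t ht => ?_
      rw [uIcc_of_le zero_le_one] at ht
      exact (IccExtend_of_mem zero_le_one (domRestrict (Icc 0 1) b) ht).symm
    · exact ContinuousOn.intervalIntegrable_of_Icc zero_le_one (hH.continuousOn_time (0, 1))
    · exact ContinuousOn.intervalIntegrable_of_Icc zero_le_one (hH.continuousOn_time (0, 0))
  -- The continuous extension of `b` to the line lets the integral be differentiated at the
  -- endpoints of `[0, 1]` too.
  have hbe : Continuous (IccExtend zero_le_one (domRestrict (Icc 0 1) b)) :=
    hbc.domRestrict.Icc_extend'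
  set S' : ℝ → ℝ := fun t => ∑ i ∈ Finset.range N,
    ((partialS (H t) (c t i) + partialS (H t) (c t (i + 1))) / 2 *
        (((c t (i + 1)).2 : ℝ) - (c t i).2) +
      ((c t i).1 + (c t (i + 1)).1) / 2 *
        (-partialTheta (H t) (c t (i + 1)) - -partialTheta (H t) (c t i))) with hS'
  have hder : ∀ t ∈ Icc (0 : ℝ) 1, HasDerivWithinAt
      (fun t => trapezoidSum N (c t) -
        ∫ τ in (0 : ℝ)..t, IccExtend zero_le_one (domRestrict (Icc 0 1) b) τ)
      (S' t - b t) (Icc 0 1) t := by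
    intro t ht
    have hi := (hbe.integral_hasStrictDerivAt 0 t).hasDerivAt.hasDerivWithinAt (s := Icc 0 1)
    rw [IccExtend_of_mem zero_le_one (domRestrict (Icc 0 1) b) ht] at hi
    refine HasDerivWithinAt.sub ?_ hi
    refine HasDerivWithinAt.fun_sum fun i _ => ?_
    have h1 := hγ (arcPoint N i) t ht
    have h2 := hγ (arcPoint N (i + 1)) t ht
    exact ((h1.1.add h2.1).div_const 2).mul (h2.2.sub h1.2)
  have hbound : ∀ t ∈ Ico (0 : ℝ) 1, ‖S' t - b t‖ ≤ N * (K * (Real.exp K / N) ^ 2) := by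
    intro t ht
    have ht := Ico_subset_Icc_self ht
    have e0 : c t 0 = ((c t 0).1, 0) := Prod.ext rfl (hbot t ht)
    have eN : c t N = ((c t N).1, 1) := Prod.ext rfl (htop t ht)
    have key := (hK t ht).abs_sum_sub_le N (c t) (fun i _ => hd t ht i)
      (by rw [e0, (hK t ht).theta_bot]) (by rw [eN, (hK t ht).theta_top])
    have hF : (H t ∘ annulusCover) (c t N) - (H t ∘ annulusCover) (c t 0) = b t := by
      rw [e0, eN]
      exact congrArg₂ (· - ·) (hb t ht _).2 (hb t ht _).1
    rw [hF] at key
    exact key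
  have key := norm_image_sub_le_of_norm_deriv_le_segment_01' hder hbound
  -- At time zero every vertex has `θ = 0`.
  have hS0 : trapezoidSum N (c 0) = 0 := by
    simp [trapezoidSum, hc, h0, arcPoint]
  rw [hS0, intervalIntegral.integral_same, ← hflux, sub_zero, sub_zero, Real.norm_eq_abs] at key
  refine key.trans (le_of_eq ?_)
  have : (N : ℝ) ≠ 0 := Nat.cast_ne_zero.2 hN
  field_simp

/-- Two isotopies that are generated by Hamiltonians that are constant on the boundary circles,
with the same time-one map and with the same lift of it along one boundary circle, have the same
flux. -/
theorem hamiltonianFlux_eq_of_lifts {H H' : ℝ → Annulus → ℝ}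
    (hH : SmoothFamilyOnAnnulus H) (hH' : SmoothFamilyOnAnnulus H')
    (hb : ∀ t ∈ Icc (0 : ℝ) 1, ∀ θ : UnitAddCircle,
      H t (θ, 0) = H t (0, 0) ∧ H t (θ, 1) = H t (0, 1))
    (hb' : ∀ t ∈ Icc (0 : ℝ) 1, ∀ θ : UnitAddCircle,
      H' t (θ, 0) = H' t (0, 0) ∧ H' t (θ, 1) = H' t (0, 1))
    {γ γ' : Strip → ℝ → Strip}
    (hγ : ∀ z, IsStripSolution (Icc 0 1) (fun t => partialTheta (H t))
      (fun t => partialS (H t)) (γ z))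
    (hγ' : ∀ z, IsStripSolution (Icc 0 1) (fun t => partialTheta (H' t))
      (fun t => partialS (H' t)) (γ' z))
    (h0 : ∀ z, γ z 0 = z) (h0' : ∀ z, γ' z 0 = z) (h1 : ∀ z, γ z 1 = γ' z 1) :
    hamiltonianFlux H = hamiltonianFlux H' := by
  obtain ⟨K, hK⟩ := hH.exists_isStripGradient hb
  obtain ⟨K', hK'⟩ := hH'.exists_isStripGradient hb'
  rw [← sub_eq_zero]
  -- The polygonal areas at time one see only the time-one lifts, so both fluxes are approximated by
  -- the same numbers.
  have hle : ∀ N : ℕ, |hamiltonianFlux H - hamiltonianFlux H'| ≤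
      (K * Real.exp K ^ 2 + K' * Real.exp K' ^ 2) * (1 / ((N : ℝ) + 1)) := by
    intro N
    have e1 := abs_trapezoidSum_sub_hamiltonianFlux_le hH hb hK hγ h0 (N.succ_ne_zero)
    have e2 := abs_trapezoidSum_sub_hamiltonianFlux_le hH' hb' hK' hγ' h0' (N.succ_ne_zero)
    simp only [h1] at e1
    rw [abs_sub_comm] at e1
    have := abs_sub_le (hamiltonianFlux H)
      (trapezoidSum N.succ fun i => γ' (arcPoint N.succ i) 1) (hamiltonianFlux H')
    push_cast at e1 e2
    rw [mul_one_div, add_div]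
    linarith
  have hlim := (tendsto_one_div_add_atTop_nhds_zero_nat (𝕜 := ℝ)).const_mul
    (K * Real.exp K ^ 2 + K' * Real.exp K' ^ 2)
  rw [mul_zero] at hlim
  exact abs_nonpos_iff.1 (ge_of_tendsto' hlim hle)

/-- The time-`t` map of the lift of a Hamiltonian flow is continuous. -/
theorem continuous_lift_of_isStripSolution {K : NNReal} {P Q : ℝ → Strip → ℝ}
    (hP : ∀ t ∈ Icc (0 : ℝ) 1, LipschitzWith K (P t))
    (hQ : ∀ t ∈ Icc (0 : ℝ) 1, LipschitzWith K (Q t)) {γ : Strip → ℝ → Strip}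
    (hγ : ∀ z, IsStripSolution (Icc 0 1) P Q (γ z)) (h0 : ∀ z, γ z 0 = z) {t : ℝ}
    (ht : t ∈ Icc (0 : ℝ) 1) : Continuous (fun z => γ z t) := by
  refine (LipschitzWith.of_dist_le_mul (K := Real.toNNReal (Real.exp (K * t)))
    fun z w => ?_).continuous
  have := (hγ z).dist_le hP hQ (hγ w) t ht
  rwa [h0, h0, sub_zero, mul_comm, ← Real.coe_toNNReal _ (Real.exp_nonneg (K * t))] at this

/-! ### Hamiltonians that are constant near the boundary -/

theorem partialTheta_eq_zero_of_constOnCollars {ε : ℝ} {F : Annulus → ℝ} (hF : ConstOnCollars ε F)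
    {z : Strip} (hz : (z.2 : ℝ) < ε ∨ 1 - ε < (z.2 : ℝ)) : partialTheta F z = 0 := by
  have : (fun θ : ℝ => inCoords F θ z.2) = fun _ => F (annulusCover z) := by
    ext θ
    rw [inCoords_coe F (θ, z.2)]
    exact hz.elim (fun h => hF.1 _ _ h h) (fun h => hF.2 _ _ h h)
  rw [partialTheta, this, deriv_const]

theorem partialS_eq_zero_of_constOnCollars {ε : ℝ} {F : Annulus → ℝ} (hF : ConstOnCollars ε F)
    {z : Strip} (hz : (z.2 : ℝ) < ε ∨ 1 - ε < (z.2 : ℝ)) : partialS F z = 0 := by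
  have hev : (fun s : ℝ => inCoords F z.1 s) =ᶠ[𝓝[Icc 0 1] (z.2 : ℝ)]
      fun _ => F (annulusCover z) := by
    have hev' : ∀ᶠ s in 𝓝[Icc 0 1] (z.2 : ℝ), ((z.2 : ℝ) < ε ∧ s < ε) ∨
        (1 - ε < (z.2 : ℝ) ∧ 1 - ε < s) := by
      refine mem_nhdsWithin_of_mem_nhds ?_
      rcases hz with hz | hz
      · filter_upwards [Iio_mem_nhds hz] with s hs using Or.inl ⟨hz, hs⟩
      · filter_upwards [Ioi_mem_nhds hz] with s hs using Or.inr ⟨hz, hs⟩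
    filter_upwards [hev', self_mem_nhdsWithin] with s hs hs'
    rw [inCoords_coe F (z.1, ⟨s, hs'⟩)]
    exact hs.elim (fun h => hF.1 _ _ h.2 h.1) (fun h => hF.2 _ _ h.2 h.1)
  rw [partialS, hev.derivWithin_eq (by rw [inCoords_coe F z]), derivWithin_fun_const]
  rfl

theorem ConstOnCollars.boundary {ε : ℝ} (hε : 0 < ε) {F : Annulus → ℝ} (hF : ConstOnCollars ε F)
    (θ : UnitAddCircle) : F (θ, 0) = F (0, 0) ∧ F (θ, 1) = F (0, 1) :=
  ⟨hF.1 _ _ (by simpa using hε) (by simpa using hε),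
    hF.2 _ _ (by simpa using hε) (by simpa using hε)⟩

/-- A solution that starts in a collar on which the Hamiltonian is constant does not move. -/
theorem IsStripSolution.eq_of_constOnCollars {H : ℝ → Annulus → ℝ} {K : NNReal} {a b ε : ℝ}
    (hP : ∀ t ∈ Icc a b, LipschitzWith K (partialTheta (H t)))
    (hQ : ∀ t ∈ Icc a b, LipschitzWith K (partialS (H t)))
    (hH : ∀ t ∈ Icc a b, ConstOnCollars ε (H t)) {γ : ℝ → Strip}
    (hγ : IsStripSolution (Icc a b) (fun t => partialTheta (H t)) (fun t => partialS (H t)) γ)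
    (hz : ((γ a).2 : ℝ) < ε ∨ 1 - ε < ((γ a).2 : ℝ)) : ∀ t ∈ Icc a b, γ t = γ a := by
  intro t ht
  have hconst : IsStripSolution (Icc a b) (fun t => partialTheta (H t))
      (fun t => partialS (H t)) (fun _ => γ a) := fun t ht => by
    beta_reduce
    rw [partialTheta_eq_zero_of_constOnCollars (hH t ht) hz,
      partialS_eq_zero_of_constOnCollars (hH t ht) hz, neg_zero]
    exact ⟨hasDerivWithinAt_const _ _ _, hasDerivWithinAt_const _ _ _⟩
  have := hγ.dist_le hP hQ hconst t ht
  rw [dist_self, zero_mul] at this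
  exact dist_le_zero.1 this

/-- A lift of the isotopy generated by a Hamiltonian that is locally constant near the boundary:
it is the identity near the boundary. -/
theorem GeneratesStationary.exists_lift {H : ℝ → Annulus → ℝ} {g : Annulus → Annulus}
    (h : GeneratesStationary H g) :
    (∀ t ∈ Icc (0 : ℝ) 1, ∀ θ : UnitAddCircle,
      H t (θ, 0) = H t (0, 0) ∧ H t (θ, 1) = H t (0, 1)) ∧
    ∃ γ : Strip → ℝ → Strip,
      (∀ z, IsStripSolution (Icc 0 1) (fun t => partialTheta (H t))
        (fun t => partialS (H t)) (γ z)) ∧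
      (∀ z, γ z 0 = z) ∧ (∀ z, annulusCover (γ z 1) = g (annulusCover z)) ∧
      Continuous (fun z => γ z 1) ∧ γ (0, 0) 1 = (0, 0) := by
  obtain ⟨hH, ⟨ε, hε, hc⟩, φ, hφ, rfl⟩ := h
  have hb := fun t ht => (hc t ht).boundary hε
  obtain ⟨K, hK⟩ := hH.exists_isStripGradient hb
  choose γ hγ h0 hγφ using hφ.exists_lift (left_mem_Icc.2 zero_le_one)
  refine ⟨hb, γ, hγ, h0, fun z => hγφ z 1 (right_mem_Icc.2 zero_le_one), ?_, ?_⟩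
  · exact continuous_lift_of_isStripSolution (fun t ht => (hK t ht).lipschitz_theta)
      (fun t ht => (hK t ht).lipschitz_s) hγ h0 (right_mem_Icc.2 zero_le_one)
  · rw [(hγ (0, 0)).eq_of_constOnCollars (fun t ht => (hK t ht).lipschitz_theta)
      (fun t ht => (hK t ht).lipschitz_s) hc (by rw [h0]; simp [hε]) 1
      (right_mem_Icc.2 zero_le_one), h0]

/-- Neither isotopy moves the boundary, so both lifts of `g` fix `(0, 0)` and therefore coincide. -/
theorem GeneratesStationary.hamiltonianFlux_eq {H H' : ℝ → Annulus → ℝ} {g : Annulus → Annulus}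
    (h : GeneratesStationary H g) (h' : GeneratesStationary H' g) :
    hamiltonianFlux H = hamiltonianFlux H' := by
  obtain ⟨hb, γ, hγ, h0, hγg, hc, hγ0⟩ := h.exists_lift
  obtain ⟨hb', γ', hγ', h0', hγg', hc', hγ0'⟩ := h'.exists_lift
  refine hamiltonianFlux_eq_of_lifts h.1 h'.1 hb hb' hγ hγ' h0 h0' (congrFun ?_)
  exact eq_of_annulusCover_eq hc hc' (fun z => (hγg z).trans (hγg' z).symm) (0, 0)
    (hγ0.trans hγ0'.symm)

/-- The flux depends only on the time-one map. -/
theorem GeneratesStationary.fluxL_eq {H : ℝ → Annulus → ℝ} {g : Annulus → Annulus}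
    (h : GeneratesStationary H g) : fluxL g = hamiltonianFlux H := by
  have hg : g ∈ HamStationary := ⟨H, h⟩
  rw [fluxL, dif_pos hg]
  exact GeneratesStationary.hamiltonianFlux_eq hg.choose_spec h

/-! ### Autonomous flows: energy and flow boxes -/

/-- Solutions for all times of an autonomous equation depend on the initial condition in a
Lipschitz way. -/
theorem IsStripSolution.dist_le_of_autonomous {K : NNReal} {P Q : Strip → ℝ}
    (hP : LipschitzWith K P) (hQ : LipschitzWith K Q) {γ δ : ℝ → Strip}
    (hγ : IsStripSolution univ (fun _ => P) (fun _ => Q) γ)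
    (hδ : IsStripSolution univ (fun _ => P) (fun _ => Q) δ) (t : ℝ) :
    dist (γ t) (δ t) ≤ dist (γ 0) (δ 0) * Real.exp (K * |t|) := by
  rcases le_total 0 t with ht | ht
  · have := (hγ.mono (subset_univ (Icc 0 t))).dist_le (fun _ _ => hP) (fun _ _ => hQ)
      (hδ.mono (subset_univ _)) t (right_mem_Icc.2 ht)
    rw [sub_zero] at this
    rwa [abs_of_nonneg ht]
  -- Negative times: the reversed curve solves the equation of `-P` and `-Q`.
  · have hrev : ∀ γ : ℝ → Strip, IsStripSolution univ (fun _ => P) (fun _ => Q) γ →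
        IsStripSolution (Icc 0 (-t)) (fun _ z => -P z) (fun _ z => -Q z) (fun τ => γ (-τ)) := by
      intro γ hγ τ _
      have h := hγ (-τ) (mem_univ _)
      rw [hasDerivWithinAt_univ, hasDerivWithinAt_univ] at h
      have hn := hasDerivAt_neg τ
      constructor
      · have := h.1.comp τ hn
        rw [mul_neg_one] at this
        exact this.hasDerivWithinAt
      · have := h.2.comp τ hn
        rw [mul_neg_one] at this
        exact this.hasDerivWithinAt
    have hneg : ∀ R : Strip → ℝ, LipschitzWith K R → LipschitzWith K (fun z => -R z) :=
      fun R hR => LipschitzWith.of_dist_le_mul fun z w => by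
        rw [dist_neg_neg]
        exact hR.dist_le_mul z w
    have := (hrev γ hγ).dist_le (fun _ _ => hneg P hP) (fun _ _ => hneg Q hQ) (hrev δ hδ) (-t)
      (right_mem_Icc.2 (neg_nonneg.2 ht))
    simpa only [neg_neg, neg_zero, sub_zero, abs_of_nonpos ht] using this

/-- `Φ` is the lift to the strip of the flow of an autonomous Hamiltonian. -/
structure IsStripFlow (K : NNReal) (F P Q : Strip → ℝ) (Φ : ℝ → Strip → Strip) : Prop
    extends IsStripGradient K F P Q where
  map_zero : ∀ z, Φ 0 z = z
  solution : ∀ z, IsStripSolution univ (fun _ => P) (fun _ => Q) (fun t => Φ t z)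

namespace IsStripFlow

variable {K : NNReal} {F P Q : Strip → ℝ} {Φ : ℝ → Strip → Strip}

theorem hasDerivAt_fst (h : IsStripFlow K F P Q Φ) (z : Strip) (t : ℝ) :
    HasDerivAt (fun t => (Φ t z).1) (Q (Φ t z)) t :=
  hasDerivWithinAt_univ.1 (h.solution z t (mem_univ t)).1

theorem hasDerivAt_snd (h : IsStripFlow K F P Q Φ) (z : Strip) (t : ℝ) :
    HasDerivAt (fun t => ((Φ t z).2 : ℝ)) (-P (Φ t z)) t :=
  hasDerivWithinAt_univ.1 (h.solution z t (mem_univ t)).2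

theorem dist_map_le (h : IsStripFlow K F P Q Φ) (t : ℝ) (z w : Strip) :
    dist (Φ t z) (Φ t w) ≤ dist z w * Real.exp (K * |t|) := by
  have := (h.solution z).dist_le_of_autonomous h.lipschitz_theta h.lipschitz_s (h.solution w) t
  rwa [h.map_zero, h.map_zero] at this

theorem eq_of_isStripSolution (h : IsStripFlow K F P Q Φ) {γ : ℝ → Strip}
    (hγ : IsStripSolution univ (fun _ => P) (fun _ => Q) γ) (t : ℝ) : γ t = Φ t (γ 0) := by
  have := hγ.dist_le_of_autonomous h.lipschitz_theta h.lipschitz_s (h.solution (γ 0)) t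
  rw [h.map_zero, dist_self, zero_mul] at this
  exact dist_le_zero.1 this

theorem map_add (h : IsStripFlow K F P Q Φ) (t u : ℝ) (z : Strip) :
    Φ (t + u) z = Φ t (Φ u z) := by
  have := h.eq_of_isStripSolution (γ := fun t => Φ (t + u) z) (fun t _ => by
    exact ⟨((h.hasDerivAt_fst z (t + u)).comp_add_const t u).hasDerivWithinAt,
      ((h.hasDerivAt_snd z (t + u)).comp_add_const t u).hasDerivWithinAt⟩) t
  simpa only [zero_add] using this

theorem map_shift (h : IsStripFlow K F P Q Φ) (t : ℝ) (n : ℤ) (z : Strip) :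
    Φ t (z.shift n) = (Φ t z).shift n := by
  have := h.eq_of_isStripSolution ((h.solution z).shift n (fun _ _ => h.theta_shift n)
    (fun _ _ => h.s_shift n)) t
  rw [this, h.map_zero]

theorem map_mul (h : IsStripFlow K F P Q Φ) {T : ℝ} {m : ℤ} {z : Strip}
    (hT : Φ T z = z.shift m) (k : ℤ) : Φ (k * T) z = z.shift ((k * m : ℤ) : ℝ) := by
  induction k using Int.induction_on with
  | zero => simp [h.map_zero]
  | succ i hi =>
    rw [Int.cast_add, Int.cast_one, add_mul, one_mul, h.map_add, hT, h.map_shift, hi,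
      Strip.shift_shift]
    push_cast
    ring_nf
  | pred i hi =>
    have e : Φ (((-(i : ℤ) - 1 : ℤ) : ℝ) * T) (Φ T z) = Φ (((-(i : ℤ) : ℤ) : ℝ) * T) z := by
      rw [← h.map_add]
      congr 1
      push_cast
      ring
    rw [hT, h.map_shift, hi] at e
    have e' := congrArg (Strip.shift (-m)) e
    rw [Strip.shift_shift, Strip.shift_shift, add_neg_cancel, Strip.shift_zero] at e'
    rw [e']
    push_cast
    ring_nf

theorem dist_time_le (h : IsStripFlow K F P Q Φ) (z : Strip) (t u : ℝ) :
    dist (Φ t z) (Φ u z) ≤ K * |t - u| := by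
  have hl : ∀ {f f' : ℝ → ℝ}, (∀ t, HasDerivAt f (f' t) t) → (∀ t, |f' t| ≤ K) →
      |f t - f u| ≤ K * |t - u| := fun hf hb =>
    convex_univ.norm_image_sub_le_of_norm_hasDerivWithin_le
      (fun x _ => (hf x).hasDerivWithinAt) (fun x _ => hb x) (mem_univ u) (mem_univ t)
  rw [Strip.dist_eq]
  refine max_le (hl (h.hasDerivAt_fst z) fun t => h.abs_s_le _)
    (hl (h.hasDerivAt_snd z) fun t => ?_)
  rw [abs_neg]
  exact h.abs_theta_le _

theorem dist_le (h : IsStripFlow K F P Q Φ) (t u : ℝ) (z w : Strip) :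
    dist (Φ t z) (Φ u w) ≤ K * |t - u| + dist z w * Real.exp (K * |u|) :=
  (dist_triangle _ (Φ u z) _).trans (add_le_add (h.dist_time_le z t u) (h.dist_map_le u z w))

theorem continuous (h : IsStripFlow K F P Q Φ) : Continuous fun p : ℝ × Strip => Φ p.1 p.2 := by
  rw [continuous_iff_continuousAt]
  rintro ⟨u, w⟩
  rw [ContinuousAt, tendsto_iff_dist_tendsto_zero]
  have hlim : Tendsto (fun p : ℝ × Strip => K * |p.1 - u| + dist p.2 w * Real.exp (K * |u|))
      (𝓝 (u, w)) (𝓝 0) := by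
    have : Continuous (fun p : ℝ × Strip =>
      (K : ℝ) * |p.1 - u| + dist p.2 w * Real.exp (K * |u|)) := by fun_prop
    simpa using this.tendsto (u, w)
  exact squeeze_zero (fun _ => dist_nonneg) (fun p => h.dist_le p.1 u p.2 w) hlim

theorem continuous_map (h : IsStripFlow K F P Q Φ) (t : ℝ) : Continuous (Φ t) :=
  h.continuous.comp (by fun_prop : Continuous fun z : Strip => (t, z))

theorem continuous_time (h : IsStripFlow K F P Q Φ) (z : Strip) : Continuous fun t => Φ t z :=
  h.continuous.comp (by fun_prop : Continuous fun t : ℝ => (t, z))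

/-- The Hamiltonian is conserved. -/
theorem energy_eq (h : IsStripFlow K F P Q Φ) (t : ℝ) (z : Strip) : F (Φ t z) = F z := by
  have hd : ∀ t, HasDerivAt (fun t => F (Φ t z)) 0 t := by
    intro t
    -- `F` is split into its linear part at `p`, whose derivative along the flow is `P Q - Q P = 0`,
    -- and a remainder that is quadratic in `u - t` by `taylor`.
    set p := Φ t z
    have h1 : HasDerivAt (fun u => P p * (Φ u z).1 + Q p * ((Φ u z).2 : ℝ)) 0 t := by
      have := ((h.hasDerivAt_fst z t).const_mul (P p)).add ((h.hasDerivAt_snd z t).const_mul (Q p))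
      rwa [show P p * Q (Φ t z) + Q p * -P (Φ t z) = 0 by simp only [p]; ring] at this
    have h2 : HasDerivAt
        (fun u => F (Φ u z) - (P p * (Φ u z).1 + Q p * ((Φ u z).2 : ℝ))) 0 t := by
      rw [hasDerivAt_iff_isLittleO]
      refine Asymptotics.IsBigO.trans_isLittleO (g := fun u => |u - t| ^ 2) ?_ ?_
      · refine Asymptotics.IsBigO.of_bound (K * K * K) (Eventually.of_forall fun u => ?_)
        have ht := h.taylor p p (Φ u z)
        rw [dist_self, add_zero] at ht
        have hdt := h.dist_time_le z u t
        rw [smul_zero, sub_zero, Real.norm_eq_abs, Real.norm_eq_abs, abs_pow, abs_abs]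
        calc _ = |F (Φ u z) - F p - P p * ((Φ u z).1 - p.1) - Q p * (((Φ u z).2 : ℝ) - p.2)| := by
              congr 1
              simp only [p]
              ring
          _ ≤ K * dist (Φ u z) p * dist (Φ u z) p := ht
          _ ≤ K * (K * |u - t|) * (K * |u - t|) := by gcongr
          _ = K * K * K * |u - t| ^ 2 := by ring
      · have := (Asymptotics.isLittleO_pow_sub_sub t (m := 2) one_lt_two)
        refine Asymptotics.IsLittleO.congr_left this fun u => ?_
        simp
    simpa using h2.fun_add h1
  have := is_const_of_deriv_eq_zero (fun t => (hd t).differentiableAt) (fun t => (hd t).deriv) t 0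
  rwa [h.map_zero] at this

/-- Near a point `p` that is not critical, a line orthogonal to the flow at `p` meets each level
only once. -/
theorem _root_.IsStripGradient.eq_of_level (h : IsStripGradient K F P Q) {p : Strip}
    (hp : P p ≠ 0 ∨ Q p ≠ 0) {R : ℝ} (hR : R * (8 * K ^ 2) ≤ P p ^ 2 + Q p ^ 2) (hR1 : R ≤ 1)
    {w z : Strip} (hwp : dist w p ≤ R) (hzp : dist z p ≤ R) (hF : F w = F z)
    (hl : Q p * (w.1 - z.1) - P p * ((w.2 : ℝ) - z.2) = 0) : w = z := by
  set c : ℝ := P p ^ 2 + Q p ^ 2 with hc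
  have hc0 : 0 < c := by
    rcases hp with hp | hp <;> positivity
  have hR0 : 0 ≤ R := dist_nonneg.trans hwp
  have ht := h.taylor p z w
  rw [hF, sub_self, zero_sub] at ht
  set d := dist w z with hd
  have ht' : |P p * (w.1 - z.1) + Q p * ((w.2 : ℝ) - z.2)| ≤ K * (2 * R) * d := by
    rw [← abs_neg]
    refine le_trans (le_of_eq (by congr 1; ring)) (ht.trans ?_)
    have : dist w p + dist z p ≤ 2 * R := by linarith
    gcongr
  -- By `hl`, `w - z` is parallel to the gradient at `p`, so there is equality in the Cauchy-Schwarz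
  -- inequality. Equal levels make the left side at most `(2 K R d) ^ 2 ≤ c / 2 * d ^ 2`, which
  -- forces `d = 0`.
  have hsq : (P p * (w.1 - z.1) + Q p * ((w.2 : ℝ) - z.2)) ^ 2 =
      c * ((w.1 - z.1) ^ 2 + ((w.2 : ℝ) - z.2) ^ 2) := by
    have : (Q p * (w.1 - z.1) - P p * ((w.2 : ℝ) - z.2)) ^ 2 = 0 := by
      rw [hl]
      ring
    simp only [hc]
    linear_combination -this
  have hd2 : d ^ 2 ≤ (w.1 - z.1) ^ 2 + ((w.2 : ℝ) - z.2) ^ 2 := by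
    rw [hd, Strip.dist_eq]
    rcases max_choice |w.1 - z.1| |(w.2 : ℝ) - z.2| with hm | hm <;> rw [hm, sq_abs]
    · exact le_add_of_nonneg_right (sq_nonneg _)
    · exact le_add_of_nonneg_left (sq_nonneg _)
  have hle : c * d ^ 2 ≤ (K * (2 * R)) ^ 2 * d ^ 2 := by
    have := pow_le_pow_left₀ (abs_nonneg _) ht' 2
    rw [sq_abs, hsq, mul_pow (K * (2 * R) : ℝ)] at this
    exact (mul_le_mul_of_nonneg_left hd2 hc0.le).trans this
  have hKR : (K * (2 * R)) ^ 2 ≤ c / 2 := by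
    have h1 : R ^ 2 ≤ R := by
      rw [sq]
      exact mul_le_of_le_one_left hR0 hR1
    have : (K : ℝ) ^ 2 * R ^ 2 ≤ K ^ 2 * R := mul_le_mul_of_nonneg_left h1 (sq_nonneg _)
    calc ((K : ℝ) * (2 * R)) ^ 2 = 4 * (K ^ 2 * R ^ 2) := by ring
      _ ≤ 4 * (K ^ 2 * R) := by linarith
      _ ≤ c / 2 := by linarith
  have hd0 : d ^ 2 ≤ 0 := by
    have h1 := mul_le_mul_of_nonneg_right hKR (sq_nonneg d)
    have h2 : c / 2 * d ^ 2 ≤ 0 := by linarith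
    exact nonpos_of_mul_nonpos_right h2 (by positivity)
  exact dist_le_zero.1 (pow_eq_zero_iff two_ne_zero |>.1 (le_antisymm hd0 (sq_nonneg d))).le

/-- Near a point that is not critical, points at the same level are on the same trajectory. -/
theorem exists_flow_box (h : IsStripFlow K F P Q Φ) {p : Strip} (hp : P p ≠ 0 ∨ Q p ≠ 0)
    {ε : ℝ} (hε : 0 < ε) :
    ∃ r > 0, ∀ y z, dist y p < r → dist z p < r → F y = F z → ∃ τ, |τ| < ε ∧ Φ τ y = z := by
  set c : ℝ := P p ^ 2 + Q p ^ 2 with hc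
  have hc0 : 0 < c := by
    rcases hp with hp | hp <;> positivity
  have hK : (0 : ℝ) ≤ K := K.2
  -- Within distance `R` of `p`, the inner product of the velocity with the velocity at `p` is at
  -- least `c / 2`. A trajectory that starts within `R / 2` stays there for times up to `e`. The
  -- last radius `r` makes the initial offset `l 0` so small that it is made up for within time `e`.
  set R : ℝ := min 1 (c / (8 * (K ^ 2 + 1))) with hR
  have hR0 : 0 < R := by positivity
  have hR1 : R ≤ 1 := min_le_left _ _
  have hR2 : R * (8 * (K ^ 2 + 1)) ≤ c := (le_div_iff₀ (by positivity)).1 (min_le_right _ _)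
  set e : ℝ := min (ε / 2) (R / (2 * (K + 1))) with he
  have he0 : 0 < e := by positivity
  have heε : e < ε := (min_le_left _ _).trans_lt (half_lt_self hε)
  have heR : e * (2 * (K + 1)) ≤ R := (le_div_iff₀ (by positivity)).1 (min_le_right _ _)
  set r : ℝ := min (R / 2) (c * e / (8 * (K + 1))) with hr
  have hr0 : 0 < r := by positivity
  have hrR : r ≤ R / 2 := min_le_left _ _
  have hrc : r * (8 * (K + 1)) ≤ c * e := (le_div_iff₀ (by positivity)).1 (min_le_right _ _)
  have hPp := h.abs_theta_le p
  have hQp := h.abs_s_le p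
  refine ⟨r, hr0, fun y z hy hz hyz => ?_⟩
  have hnear : ∀ t, |t| ≤ e → dist (Φ t y) p ≤ R := by
    intro t ht
    have h1 := h.dist_time_le y t 0
    rw [h.map_zero, sub_zero] at h1
    have h2 := dist_triangle (Φ t y) y p
    nlinarith [abs_nonneg t]
  -- Up to scale, `l t` is the displacement from `z` to `Φ t y` along the flow direction at `p`. At
  -- a zero of `l` the two points lie on one transversal and on one level.
  set l : ℝ → ℝ := fun t => Q p * ((Φ t y).1 - z.1) - P p * (((Φ t y).2 : ℝ) - z.2) with hl
  have hld : ∀ t, HasDerivAt l (Q p * Q (Φ t y) + P p * P (Φ t y)) t := by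
    intro t
    exact ((((h.hasDerivAt_fst y t).sub_const z.1).const_mul (Q p)).fun_sub
      (((h.hasDerivAt_snd y t).sub_const (z.2 : ℝ)).const_mul (P p))).congr_deriv (by ring)
  have hlc : Continuous l := continuous_iff_continuousAt.2 fun t => (hld t).continuousAt
  have hld' : ∀ t, |t| ≤ e → c / 2 ≤ deriv l t := by
    intro t ht
    rw [(hld t).deriv]
    have hd := hnear t ht
    have h1 : |P (Φ t y) - P p| ≤ K * R :=
      (h.lipschitz_theta.dist_le_mul _ _).trans (mul_le_mul_of_nonneg_left hd hK)
    have h2 : |Q (Φ t y) - Q p| ≤ K * R :=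
      (h.lipschitz_s.dist_le_mul _ _).trans (mul_le_mul_of_nonneg_left hd hK)
    have h3 : |P p * (P (Φ t y) - P p)| ≤ K * (K * R) := by
      rw [abs_mul]
      exact mul_le_mul hPp h1 (abs_nonneg _) hK
    have h4 : |Q p * (Q (Φ t y) - Q p)| ≤ K * (K * R) := by
      rw [abs_mul]
      exact mul_le_mul hQp h2 (abs_nonneg _) hK
    have h5 := neg_abs_le (P p * (P (Φ t y) - P p))
    have h6 := neg_abs_le (Q p * (Q (Φ t y) - Q p))
    nlinarith
  have hgrow : ∀ x ∈ Icc (-e) e, ∀ x' ∈ Icc (-e) e, x ≤ x' → c / 2 * (x' - x) ≤ l x' - l x :=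
    (convex_Icc (-e) e).mul_sub_le_image_sub_of_le_deriv hlc.continuousOn
      (fun t _ => (hld t).differentiableAt.differentiableWithinAt) (fun t ht => by
        rw [interior_Icc] at ht
        exact hld' t (abs_le.2 ⟨ht.1.le, ht.2.le⟩))
  have hl0 : |l 0| ≤ 2 * (K * (2 * r)) := by
    have hyz' : dist y z ≤ 2 * r := by
      have := dist_triangle_right y z p
      linarith
    rw [Strip.dist_eq] at hyz'
    have h1 := (le_max_left _ _).trans hyz'
    have h2 := (le_max_right _ _).trans hyz'
    simp only [hl, h.map_zero]
    refine (abs_sub _ _).trans ?_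
    rw [abs_mul, abs_mul]
    have h3 := mul_le_mul hQp h1 (abs_nonneg _) hK
    have h4 := mul_le_mul hPp h2 (abs_nonneg _) hK
    linarith
  have hr4 : 2 * (K * (2 * r)) ≤ c / 2 * e := by nlinarith
  have hpos : 0 ≤ l e := by
    have := hgrow 0 ⟨by linarith, he0.le⟩ e ⟨by linarith, le_rfl⟩ he0.le
    have h2 := neg_abs_le (l 0)
    linarith
  have hneg : l (-e) ≤ 0 := by
    have := hgrow (-e) ⟨le_rfl, by linarith⟩ 0 ⟨by linarith, he0.le⟩ (by linarith)
    have h2 := le_abs_self (l 0)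
    linarith
  obtain ⟨τ, hτ, hτ0⟩ := intermediate_value_Icc (by linarith : -e ≤ e) hlc.continuousOn
    ⟨hneg, hpos⟩
  refine ⟨τ, (abs_le.2 hτ).trans_lt heε, ?_⟩
  exact h.toIsStripGradient.eq_of_level hp (by nlinarith) hR1 (hnear τ (abs_le.2 hτ)) (by linarith)
    ((h.energy_eq τ y).trans hyz) hτ0

end IsStripFlow

/-! ### The Poincaré-Miranda theorem and closed trajectories -/

/-- A continuous angle whose cosine is nonnegative stays in one right half plane. -/
theorem exists_forall_abs_sub_le_of_cos_nonneg {A : ℝ → ℝ} (hA : Continuous A) {x y : ℝ}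
    (hxy : x ≤ y) (h : ∀ t ∈ Icc x y, 0 ≤ Real.cos (A t)) :
    ∃ n : ℤ, ∀ t ∈ Icc x y, |A t - 2 * Real.pi * n| ≤ Real.pi / 2 := by
  have hpi := Real.pi_pos
  set n : ℤ := round (A x / (2 * Real.pi)) with hn
  have hcos : ∀ t, Real.cos |A t - 2 * Real.pi * n| = Real.cos (A t) := fun t => by
    rw [Real.cos_abs, show A t - 2 * Real.pi * n = A t - n * (2 * Real.pi) by ring,
      Real.cos_sub_int_mul_two_pi]
  have hsmall : ∀ v, v ≤ Real.pi → 0 ≤ Real.cos v → v ≤ Real.pi / 2 := fun v hv hc => by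
    by_contra! hlt
    exact absurd (Real.cos_neg_of_pi_div_two_lt_of_lt hlt (by linarith)) (not_lt.2 hc)
  have hx : |A x - 2 * Real.pi * n| ≤ Real.pi / 2 := by
    refine hsmall _ ?_ (by rw [hcos]; exact h x (left_mem_Icc.2 hxy))
    have h1 := abs_sub_round (A x / (2 * Real.pi))
    have h2 : A x - 2 * Real.pi * n = 2 * Real.pi * (A x / (2 * Real.pi) - n) := by
      field_simp
    rw [h2, abs_mul, abs_of_pos (by positivity : 0 < 2 * Real.pi)]
    nlinarith
  refine ⟨n, fun t ht => ?_⟩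
  by_contra! hlt
  -- An angle that leaves the half plane takes, on the way, a distance `v` from `2πn` with `π / 2 <
  -- v ≤ π`, where the cosine is negative.
  set v := min |A t - 2 * Real.pi * n| Real.pi with hv
  have hv2 : Real.pi / 2 < v := lt_min hlt (by linarith)
  obtain ⟨u, hu, huv⟩ := intermediate_value_Icc ht.1
    (f := fun t => |A t - 2 * Real.pi * n|) (by fun_prop) ⟨hx.trans hv2.le, min_le_left _ _⟩
  have h1 := hcos u
  rw [show |A u - 2 * Real.pi * n| = v from huv] at h1
  exact absurd (hsmall v (min_le_right _ _) (h1 ▸ h u ⟨hu.1, hu.2.trans ht.2⟩)) (not_le.2 hv2)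

/-- A nonvanishing continuous map from the plane to the plane has polar coordinates. -/
theorem exists_continuous_polar {f g : ℝ × ℝ → ℝ} (hf : Continuous f) (hg : Continuous g)
    (h : ∀ p, f p ≠ 0 ∨ g p ≠ 0) :
    ∃ A : ℝ × ℝ → ℝ, Continuous A ∧ ∃ R : ℝ × ℝ → ℝ, (∀ p, 0 < R p) ∧
      ∀ p, f p = R p * Real.cos (A p) ∧ g p = R p * Real.sin (A p) := by
  set D : C(ℝ × ℝ, ℂ) := ⟨fun p => f p + g p * Complex.I, by fun_prop⟩ with hD
  have hD0 : ∀ p, D p ∈ ({0}ᶜ : Set ℂ) := by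
    intro p hp
    have h1 := congrArg Complex.re hp
    have h2 := congrArg Complex.im hp
    simp [hD] at h1 h2
    exact (h p).elim (fun h => h h1) (fun h => h h2)
  obtain ⟨L, ⟨-, hL⟩, -⟩ := Complex.isCoveringMapOn_exp.existsUnique_continuousMap_lifts D
    (a₀ := (0, 0)) (Complex.exp_log (hD0 (0, 0))) hD0
  refine ⟨fun p => (L p).im, by fun_prop, fun p => Real.exp (L p).re, fun p => Real.exp_pos _,
    fun p => ?_⟩
  have hp : Complex.exp (L p) = f p + g p * Complex.I := congrFun hL p
  constructor
  · rw [← Complex.exp_re, hp]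
    simp
  · rw [← Complex.exp_im, hp]
    simp

/-- The theorem of Poincaré and Miranda in dimension two. -/
theorem exists_common_zero {f g : ℝ × ℝ → ℝ} (hf : Continuous f) (hg : Continuous g)
    {a b c d : ℝ} (hab : a ≤ b) (hcd : c ≤ d)
    (h1 : ∀ u ∈ Icc c d, f (a, u) < 0) (h2 : ∀ u ∈ Icc c d, 0 < f (b, u))
    (h3 : ∀ t ∈ Icc a b, 0 ≤ g (t, c)) (h4 : ∀ t ∈ Icc a b, g (t, d) ≤ 0) :
    ∃ p, f p = 0 ∧ g p = 0 := by
  by_contra! hne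
  obtain ⟨A, hA, R, hR, hfg⟩ := exists_continuous_polar hf hg fun p => by
    by_cases hp : f p = 0
    · exact Or.inr (hne p hp)
    · exact Or.inl hp
  have hpi := Real.pi_pos
  have hcos : ∀ p, f p = R p * Real.cos (A p) := fun p => (hfg p).1
  have hsin : ∀ p, g p = R p * Real.sin (A p) := fun p => (hfg p).2
  -- With no common zero, `(f, g)` has a continuous angle `A`. On each side of the rectangle it
  -- stays within `π / 2` of a centre: `2πi` on the right, `π + 2πj` on the left, `π / 2 + 2πk` at
  -- `u = c` and `-π / 2 + 2πl` at `u = d`. Comparison at the four corners says that `A` winds once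
  -- around the boundary, so the integers contradict each other.
  obtain ⟨i, hi⟩ := exists_forall_abs_sub_le_of_cos_nonneg (A := fun u => A (b, u))
    (by fun_prop) hcd fun u hu => (pos_of_mul_pos_right (hcos _ ▸ h2 u hu) (hR _).le).le
  obtain ⟨j, hj⟩ := exists_forall_abs_sub_le_of_cos_nonneg (A := fun u => A (a, u) - Real.pi)
    (by fun_prop) hcd fun u hu => by
      rw [Real.cos_sub_pi]
      exact (neg_pos.2 (neg_of_mul_neg_right (hcos _ ▸ h1 u hu) (hR _).le)).le
  obtain ⟨k, hk⟩ := exists_forall_abs_sub_le_of_cos_nonneg (A := fun t => A (t, c) - Real.pi / 2)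
    (by fun_prop) hab fun t ht => by
      rw [Real.cos_sub_pi_div_two]
      exact nonneg_of_mul_nonneg_right (hsin _ ▸ h3 t ht) (hR _)
  obtain ⟨l, hl⟩ := exists_forall_abs_sub_le_of_cos_nonneg (A := fun t => A (t, d) + Real.pi / 2)
    (by fun_prop) hab fun t ht => by
      rw [Real.cos_add_pi_div_two]
      exact neg_nonneg.2 (nonpos_of_mul_nonpos_right (hsin _ ▸ h4 t ht) (hR _))
  have hint : ∀ m n : ℤ, 2 * Real.pi * m < 2 * Real.pi * n + 2 * Real.pi → m ≤ n := by
    intro m n hmn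
    have : (m : ℝ) < n + 1 := by
      refine lt_of_mul_lt_mul_left ?_ (by positivity : 0 ≤ 2 * Real.pi)
      linarith
    exact Int.lt_add_one_iff.1 (by exact_mod_cast this)
  have i1 := abs_le.1 (hi d (right_mem_Icc.2 hcd))
  have i2 := abs_le.1 (hi c (left_mem_Icc.2 hcd))
  have j1 := abs_le.1 (hj d (right_mem_Icc.2 hcd))
  have j2 := abs_le.1 (hj c (left_mem_Icc.2 hcd))
  have k1 := abs_le.1 (hk b (right_mem_Icc.2 hab))
  have k2 := abs_le.1 (hk a (left_mem_Icc.2 hab))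
  have l1 := abs_le.1 (hl b (right_mem_Icc.2 hab))
  have l2 := abs_le.1 (hl a (left_mem_Icc.2 hab))
  have hkj : k ≤ j := hint _ _ (by linarith)
  have hjl : j + 1 ≤ l := hint _ _ (by push_cast; linarith)
  have hli : l ≤ i := hint _ _ (by linarith)
  have hik : i ≤ k := hint _ _ (by linarith)
  omega

namespace IsStripFlow

variable {K : NNReal} {F P Q : Strip → ℝ} {Φ : ℝ → Strip → Strip}

/-- On the universal cover, a trajectory that is periodic up to a translation in the direction of
`θ` meets its own translate by one. -/
theorem exists_map_eq_shift_one (h : IsStripFlow K F P Q Φ) {T : ℝ} {m : ℤ} {z : Strip}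
    (hT : 0 < T) (hm : m ≠ 0) (hz : Φ T z = z.shift m) :
    ∃ T' : ℝ, T' ≠ 0 ∧ Φ T' z = z.shift 1 := by
  have hc := h.continuous_time z
  have hper : ∀ t (k : ℤ), Φ (t + k * T) z = (Φ t z).shift ((k * m : ℤ) : ℝ) := fun t k => by
    rw [h.map_add, h.map_mul hz, h.map_shift]
  set s : ℝ → ℝ := fun t => ((Φ t z).2 : ℝ) with hs
  set θ : ℝ → ℝ := fun t => (Φ t z).1 with hθ
  have hsc : Continuous s := by fun_prop
  have hθc : Continuous θ := by fun_prop
  have hsper : ∀ t (k : ℤ), s (t + k * T) = s t := fun t k => by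
    simp only [hs, hper, Strip.shift_snd]
  have hθper : ∀ t (k : ℤ), θ (t + k * T) = θ t + k * m := fun t k => by
    simp only [hθ, hper, Strip.shift_fst]
    push_cast
    ring
  have hred : ∀ t, ∃ t' ∈ Icc 0 T, s t = s t' := fun t => by
    obtain ⟨k, hk, -⟩ := existsUnique_add_zsmul_mem_Ico hT t 0
    rw [zero_add, zsmul_eq_mul] at hk
    exact ⟨_, Ico_subset_Icc_self hk, (hsper t k).symm⟩
  -- The height `s` is periodic, so its extrema over one period are global.
  obtain ⟨u₀, hu₀, hmin⟩ := isCompact_Icc.exists_isMinOn (nonempty_Icc.2 hT.le)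
    hsc.continuousOn
  obtain ⟨u₁, hu₁, hmax⟩ := isCompact_Icc.exists_isMaxOn (nonempty_Icc.2 hT.le)
    hsc.continuousOn
  have hmin' : ∀ t, s u₀ ≤ s t := fun t => by
    obtain ⟨t', ht', e⟩ := hred t
    rw [e]
    exact hmin ht'
  have hmax' : ∀ t, s t ≤ s u₁ := fun t => by
    obtain ⟨t', ht', e⟩ := hred t
    rw [e]
    exact hmax ht'
  obtain ⟨B, hB⟩ := (isCompact_Icc (a := 0) (b := T + T)).exists_bound_of_continuousOn
    hθc.continuousOn
  -- `θ` is bounded by `B` on the range of `u`, so `N` periods carry the first point beyond the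
  -- translate of every such point.
  obtain ⟨N, hN⟩ := exists_nat_gt (2 * B + 1)
  have hB' : ∀ u ∈ Icc u₀ (u₁ + T), |θ u| ≤ B := fun u hu =>
    hB u ⟨hu₀.1.trans hu.1, hu.2.trans (by linarith [hu₁.2])⟩
  have hB0 := abs_le.1 (hB 0 ⟨le_rfl, by linarith⟩)
  have hθN : ∀ k : ℤ, θ (m.sign * (k * T)) = θ 0 + k * |(m : ℝ)| := fun k => by
    have := hθper 0 (m.sign * k)
    rw [zero_add] at this
    rw [← mul_assoc, ← Int.cast_mul, this, ← Int.cast_abs, ← Int.sign_mul_self_eq_abs]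
    push_cast
    ring
  have hm1 : (1 : ℝ) ≤ |(m : ℝ)| := by
    rw [← Int.cast_abs]
    exact_mod_cast Int.one_le_abs hm
  have hNm : (N : ℝ) ≤ N * |(m : ℝ)| := le_mul_of_one_le_right (Nat.cast_nonneg _) hm1
  have hNT : 0 ≤ N * T := by positivity
  -- A common zero is a point of the trajectory that is the translate by one of another of its
  -- points. In `t`, oriented by the sign of `m`, the trajectory crosses from far left to far right;
  -- in `u` it runs from a lowest point to a highest one. The time `u₁ + T` replaces `u₁` so that it
  -- comes after `u₀`.
  obtain ⟨⟨t, u⟩, h1, h2⟩ := exists_common_zero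
    (f := fun p => θ (m.sign * p.1) - θ p.2 - 1) (g := fun p => s (m.sign * p.1) - s p.2)
    (a := -(N * T)) (b := N * T) (c := u₀) (d := u₁ + T) (by fun_prop) (by fun_prop)
    (by linarith) (by linarith [hu₀.2, hu₁.1])
    (fun u hu => by
      have := abs_le.1 (hB' u hu)
      have e := hθN (-N)
      push_cast at e
      simp only [← neg_mul, e]
      linarith)
    (fun u hu => by
      have := abs_le.1 (hB' u hu)
      have e := hθN N
      push_cast at e
      simp only [e]
      linarith)
    (fun t _ => sub_nonneg.2 (hmin' _))
    (fun t _ => by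
      have := hsper u₁ 1
      rw [Int.cast_one, one_mul] at this
      simp only [this]
      exact sub_nonpos.2 (hmax' _))
  have heq : Φ (m.sign * t) z = (Φ u z).shift (1 : ℤ) := by
    refine Prod.ext ?_ (Subtype.ext (sub_eq_zero.1 h2))
    rw [Strip.shift_fst, Int.cast_one]
    simp only [hθ] at h1
    linarith
  refine ⟨-u + m.sign * t, fun h0 => ?_, ?_⟩
  · have : m.sign * t = u := by linarith
    rw [this] at heq
    have := congrArg Prod.fst heq
    simp at this
  · rw [h.map_add, heq, h.map_shift, ← h.map_add, neg_add_cancel, h.map_zero, Int.cast_one]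

end IsStripFlow

/-! ### Existence and continuity of rotation numbers -/

theorem tendsto_div_of_abs_sub_mul_le {f : ℝ → ℝ} {ρ C : ℝ} (h : ∀ t, |f t - ρ * t| ≤ C) :
    Tendsto (fun t => f t / t) atTop (𝓝 ρ) := by
  rw [tendsto_iff_dist_tendsto_zero]
  refine squeeze_zero' (Eventually.of_forall fun _ => dist_nonneg) ?_
    (tendsto_const_nhds.div_atTop tendsto_id : Tendsto (fun t : ℝ => C / t) atTop (𝓝 0))
  filter_upwards [eventually_gt_atTop 0] with t ht
  rw [Real.dist_eq, div_sub' ht.ne', abs_div, abs_of_pos ht, mul_comm t ρ]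
  exact div_le_div_of_nonneg_right (h t) ht.le

theorem tendsto_div_of_tendsto_deriv_zero {f f' : ℝ → ℝ} (hf : ∀ t, HasDerivAt f (f' t) t)
    (hf' : Tendsto f' atTop (𝓝 0)) : Tendsto (fun t => f t / t) atTop (𝓝 0) := by
  rw [Metric.tendsto_nhds]
  intro ε hε
  obtain ⟨a, ha⟩ := eventually_atTop.1 (Metric.tendsto_nhds.1 hf' (ε / 2) (half_pos hε))
  have hlim : Tendsto (fun t : ℝ => |f a| / t + ε / 2 * |a| / t) atTop (𝓝 0) := by
    have h1 : Tendsto (fun t : ℝ => |f a| / t) atTop (𝓝 0) :=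
      tendsto_const_nhds.div_atTop tendsto_id
    have h2 : Tendsto (fun t : ℝ => ε / 2 * |a| / t) atTop (𝓝 0) :=
      tendsto_const_nhds.div_atTop tendsto_id
    simpa using h1.add h2
  filter_upwards [eventually_ge_atTop a, eventually_gt_atTop 0,
    hlim.eventually (gt_mem_nhds (half_pos hε))] with t hat ht hsmall
  have hb : ‖f t - f a‖ ≤ ε / 2 * ‖t - a‖ :=
    (convex_Ici a).norm_image_sub_le_of_norm_hasDerivWithin_le
      (fun x _ => (hf x).hasDerivWithinAt)
      (fun x hx => by have := ha x hx; rw [dist_zero_right] at this; exact this.le)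
      self_mem_Ici hat
  rw [Real.norm_eq_abs, Real.norm_eq_abs, abs_of_nonneg (sub_nonneg.2 hat)] at hb
  rw [dist_zero_right, Real.norm_eq_abs, abs_div, abs_of_pos ht]
  have h1 : |f t| ≤ |f a| + ε / 2 * |a| + ε / 2 * t := by
    have h2 := abs_sub_abs_le_abs_sub (f t) (f a)
    have h3 := neg_abs_le a
    nlinarith
  calc |f t| / t ≤ (|f a| + ε / 2 * |a| + ε / 2 * t) / t := div_le_div_of_nonneg_right h1 ht.le
    _ = |f a| / t + ε / 2 * |a| / t + ε / 2 := by field_simp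
    _ < ε := by linarith

theorem Strip.ne_shift_one (z : Strip) : z ≠ z.shift 1 := fun h => by
  have := congrArg Prod.fst h
  simp at this

theorem Strip.continuous_shift (a : ℝ) : Continuous (Strip.shift a) := by
  unfold Strip.shift
  fun_prop

/-- The mean velocity in the direction of `θ` of the trajectory through `z`. -/
noncomputable def stripRotation (Φ : ℝ → Strip → Strip) (z : Strip) : ℝ :=
  limUnder atTop fun t : ℝ => ((Φ t z).1 - z.1) / t

namespace IsStripFlow

variable {K : NNReal} {F P Q : Strip → ℝ} {Φ : ℝ → Strip → Strip}

/-- With `t = k T + r` and `|r| ≤ |T|`, the whole periods contribute `k m` and the rest is bounded.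
Negative `T` is allowed because the time of one turn to the right may be negative. -/
theorem tendsto_of_map_eq_shift (h : IsStripFlow K F P Q Φ) {T : ℝ} {m : ℤ} {z : Strip}
    (hT : T ≠ 0) (hz : Φ T z = z.shift m) :
    Tendsto (fun t => ((Φ t z).1 - z.1) / t) atTop (𝓝 (m / T)) := by
  refine tendsto_div_of_abs_sub_mul_le (C := K * |T| + |(m : ℝ)|) fun t => ?_
  set k := ⌊t / T⌋
  set r := t - k * T with hr
  have hrT : r = Int.fract (t / T) * T := by
    rw [hr, Int.fract, sub_mul, div_mul_cancel₀ _ hT]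
  have hrle : |r| ≤ |T| := by
    rw [hrT, abs_mul, abs_of_nonneg (Int.fract_nonneg _)]
    exact mul_le_of_le_one_left (abs_nonneg _) (Int.fract_lt_one _).le
  have ht : Φ t z = (Φ r z).shift ((k * m : ℤ) : ℝ) := by
    rw [← h.map_shift, ← h.map_mul hz, ← h.map_add, hr, sub_add_cancel]
  have hd := h.dist_time_le z r 0
  rw [h.map_zero, sub_zero, Strip.dist_eq] at hd
  have hd1 : |(Φ r z).1 - z.1| ≤ K * |T| :=
    ((le_max_left _ _).trans hd).trans (mul_le_mul_of_nonneg_left hrle K.2)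
  have hd2 : |m / T * r| ≤ |(m : ℝ)| := by
    rw [abs_mul, abs_div, div_mul_eq_mul_div]
    exact div_le_of_le_mul₀ (abs_nonneg _) (abs_nonneg _)
      (mul_le_mul_of_nonneg_left hrle (abs_nonneg _))
  have e : (Φ t z).1 - z.1 - m / T * t = ((Φ r z).1 - z.1) - m / T * r := by
    rw [ht, Strip.shift_fst, hr]
    push_cast
    field_simp
    ring
  rw [e]
  exact (abs_sub _ _).trans (add_le_add hd1 hd2)

/-- A trajectory either is periodic in the annulus, or its velocity in the direction of `θ` tends
to zero. -/
theorem exists_period_or_tendsto_zero (h : IsStripFlow K F P Q Φ) (z : Strip) :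
    (∃ (T : ℝ) (m : ℤ), 0 < T ∧ Φ T z = z.shift m) ∨
      Tendsto (fun t => Q (Φ t z)) atTop (𝓝 0) := by
  refine or_iff_not_imp_right.2 fun hnot => ?_
  simp only [Metric.tendsto_nhds, not_forall, not_eventually, not_lt, dist_zero_right] at hnot
  obtain ⟨δ, hδ, hfreq⟩ := hnot
  -- Arbitrarily late points with `|Q| ≥ δ`, moved back to one period of the strip, accumulate at a
  -- point `p` with `Q p ≠ 0`.
  choose t ht htδ using fun n : ℕ => frequently_atTop.1 hfreq (n : ℝ)
  set w : ℕ → Strip := fun n => (Φ (t n) z).shift ((-⌊(Φ (t n) z).1⌋ : ℤ) : ℝ) with hw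
  have hwmem : ∀ n, w n ∈ (Icc 0 1 ×ˢ univ : Set Strip) := fun n => by
    have h1 := Int.floor_le (Φ (t n) z).1
    have h2 := Int.lt_floor_add_one (Φ (t n) z).1
    refine ⟨⟨?_, ?_⟩, mem_univ _⟩ <;> simp [hw] <;> linarith
  obtain ⟨p, -, ψ, hψ, hlim⟩ := (isCompact_Icc.prod isCompact_univ).tendsto_subseq hwmem
  have hp : δ ≤ ‖Q p‖ := by
    have hQ := (h.lipschitz_s.continuous.norm.tendsto p).comp hlim
    refine ge_of_tendsto' hQ fun n => ?_
    simp only [Function.comp_apply, hw, h.s_shift]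
    exact htδ _
  have hp0 : Q p ≠ 0 := fun h0 => by
    rw [h0, norm_zero] at hp
    exact absurd hp (not_le.2 hδ)
  -- Two late visits to the flow box of `p` have equal energy, so a trajectory piece of duration
  -- less than 1 joins them. The visits are chosen more than 1 apart in time, which makes the
  -- resulting period positive.
  obtain ⟨r, hr, hbox⟩ := h.exists_flow_box (Or.inr hp0) one_pos
  obtain ⟨n, hn⟩ := eventually_atTop.1 (Metric.tendsto_nhds.1 hlim r hr)
  obtain ⟨n', hn'⟩ := exists_nat_gt (t (ψ n) + 1)
  set i := ψ n
  set j := ψ (max n n')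
  have hij : t i + 1 < t j := by
    have h1 : (n' : ℝ) ≤ j := by
      exact_mod_cast (le_max_right n n').trans hψ.le_apply
    linarith [ht j]
  have hF : F (w i) = F (w j) := by
    simp only [hw, h.shift_eq, h.energy_eq]
  obtain ⟨τ, hτ, hτw⟩ := hbox _ _ (hn n le_rfl) (hn _ (le_max_left _ _)) hF
  have hτ' := abs_lt.1 hτ
  set a := -⌊(Φ (t i) z).1⌋
  set b := -⌊(Φ (t j) z).1⌋
  have e1 : Φ (τ + t i) z = (Φ (t j) z).shift ((b - a : ℤ) : ℝ) := by
    have : (Φ (τ + t i) z).shift a = (Φ (t j) z).shift b := by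
      rw [h.map_add, ← h.map_shift]
      exact hτw
    have := congrArg (Strip.shift ((-a : ℤ) : ℝ)) this
    rw [Strip.shift_shift, Strip.shift_shift, ← Int.cast_add, ← Int.cast_add, add_neg_cancel,
      Int.cast_zero, Strip.shift_zero] at this
    rw [this, sub_eq_add_neg]
  refine ⟨t j - (τ + t i), a - b, by linarith, ?_⟩
  have e2 : Φ (-(τ + t i)) (Φ (τ + t i) z) = z := by
    rw [← h.map_add, neg_add_cancel, h.map_zero]
  rw [e1, h.map_shift, ← h.map_add] at e2
  have e3 := congrArg (Strip.shift ((a - b : ℤ) : ℝ)) e2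
  rw [Strip.shift_shift, ← Int.cast_add, show b - a + (a - b) = 0 by ring, Int.cast_zero,
    Strip.shift_zero] at e3
  rw [← e3]
  congr 1
  ring

/-- Closed trajectories with no net translation, and those along which `Q` tends to zero, have
rotation number 0. The others close up in the annulus after a single turn, which makes every nonzero
rotation number the inverse of a turning time. -/
theorem exists_rotation (h : IsStripFlow K F P Q Φ) (z : Strip) :
    ∃ ρ, Tendsto (fun t => ((Φ t z).1 - z.1) / t) atTop (𝓝 ρ) ∧
      (ρ = 0 ∨ ∃ T ≠ 0, Φ T z = z.shift 1 ∧ ρ = 1 / T) := by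
  rcases h.exists_period_or_tendsto_zero z with ⟨T, m, hT, hz⟩ | hlim
  · rcases eq_or_ne m 0 with rfl | hm
    · refine ⟨_, h.tendsto_of_map_eq_shift hT.ne' hz, Or.inl ?_⟩
      rw [Int.cast_zero, zero_div]
    · obtain ⟨T', hT', hz'⟩ := h.exists_map_eq_shift_one hT hm hz
      refine ⟨1 / T', ?_, Or.inr ⟨T', hT', hz', rfl⟩⟩
      have := h.tendsto_of_map_eq_shift (m := 1) hT' (by rw [hz', Int.cast_one])
      rwa [Int.cast_one] at this
  · exact ⟨0, tendsto_div_of_tendsto_deriv_zero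
      (fun t => (h.hasDerivAt_fst z t).sub_const z.1) hlim, Or.inl rfl⟩

theorem tendsto_stripRotation (h : IsStripFlow K F P Q Φ) (z : Strip) :
    Tendsto (fun t => ((Φ t z).1 - z.1) / t) atTop (𝓝 (stripRotation Φ z)) :=
  tendsto_nhds_limUnder ((h.exists_rotation z).imp fun _ => And.left)

theorem stripRotation_eq_zero_or (h : IsStripFlow K F P Q Φ) (z : Strip) :
    stripRotation Φ z = 0 ∨
      ∃ T ≠ 0, Φ T z = z.shift 1 ∧ stripRotation Φ z = 1 / T := by
  obtain ⟨ρ, hρ, hρ'⟩ := h.exists_rotation z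
  rwa [tendsto_nhds_unique (h.tendsto_stripRotation z) hρ]

theorem stripRotation_eq (h : IsStripFlow K F P Q Φ) {T : ℝ} {m : ℤ} {z : Strip}
    (hT : T ≠ 0) (hz : Φ T z = z.shift m) : stripRotation Φ z = m / T :=
  tendsto_nhds_unique (h.tendsto_stripRotation z) (h.tendsto_of_map_eq_shift hT hz)

theorem stripRotation_eq_one_div (h : IsStripFlow K F P Q Φ) {T : ℝ} {z : Strip}
    (hT : T ≠ 0) (hz : Φ T z = z.shift 1) : stripRotation Φ z = 1 / T := by
  have := h.stripRotation_eq (m := 1) hT (by rw [hz, Int.cast_one])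
  rwa [Int.cast_one] at this

theorem stripRotation_shift (h : IsStripFlow K F P Q Φ) (n : ℤ) (z : Strip) :
    stripRotation Φ (z.shift n) = stripRotation Φ z := by
  simp only [stripRotation, h.map_shift, Strip.shift_fst, add_sub_add_right_eq_sub]

theorem map_eq_self_of_critical (h : IsStripFlow K F P Q Φ) {z : Strip} (hP : P z = 0)
    (hQ : Q z = 0) (t : ℝ) : Φ t z = z := by
  refine (h.eq_of_isStripSolution (γ := fun _ => z) (fun t _ => ?_) t).symm
  beta_reduce
  rw [hP, hQ, neg_zero]
  exact ⟨hasDerivWithinAt_const _ _ _, hasDerivWithinAt_const _ _ _⟩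

/-- If points `y n` tending to `x` had rotation numbers of size at least `ε`, their turning times
would lie in `[-1/ε, 1/ε]`, and a limit of these would be a turning time of `x`, whose rotation
number would then be nonzero. -/
theorem continuousAt_stripRotation_of_eq_zero (h : IsStripFlow K F P Q Φ) {x : Strip}
    (hx : stripRotation Φ x = 0) : ContinuousAt (stripRotation Φ) x := by
  rw [ContinuousAt, hx, Metric.tendsto_nhds]
  intro ε hε
  by_contra hnot
  simp only [not_eventually, not_lt, dist_zero_right] at hnot
  obtain ⟨y, hy, hyε⟩ := exists_seq_forall_of_frequently hnot
  have hT : ∀ n, ∃ T ∈ Icc (-(1 / ε)) (1 / ε), Φ T (y n) = (y n).shift 1 := fun n => by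
    rcases h.stripRotation_eq_zero_or (y n) with h0 | ⟨T, hT, hz, hr⟩
    · have := hyε n
      rw [h0, norm_zero] at this
      exact absurd this (not_le.2 hε)
    · refine ⟨T, abs_le.1 ?_, hz⟩
      have := hyε n
      rw [hr, norm_div, norm_one, Real.norm_eq_abs, le_div_comm₀ hε (abs_pos.2 hT)] at this
      exact this
  choose T hTmem hTy using hT
  obtain ⟨S, -, ψ, hψ, hlim⟩ := isCompact_Icc.tendsto_subseq hTmem
  have hy' := hy.comp hψ.tendsto_atTop
  have h1 : Tendsto (fun n => Φ (T (ψ n)) (y (ψ n))) atTop (𝓝 (Φ S x)) :=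
    (h.continuous.tendsto (S, x)).comp (hlim.prodMk_nhds hy')
  have h2 : Tendsto (fun n => Φ (T (ψ n)) (y (ψ n))) atTop (𝓝 (x.shift 1)) := by
    simp only [hTy]
    exact ((Strip.continuous_shift 1).tendsto x).comp hy'
  have hS := tendsto_nhds_unique h1 h2
  have hS0 : S ≠ 0 := by
    rintro rfl
    rw [h.map_zero] at hS
    exact x.ne_shift_one hS
  rw [h.stripRotation_eq_one_div hS0 hS] at hx
  exact one_div_ne_zero hS0 hx

/-- For `y` near `x`, the point `Φ T y` moved back by one is near `x` and on the level of `y`. The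
flow box joins it to `y` in a short time `τ`, so `y` makes one turn in time `T - τ`. -/
theorem continuousAt_stripRotation_of_map_eq (h : IsStripFlow K F P Q Φ) {x : Strip} {T : ℝ}
    (hT : T ≠ 0) (hx : Φ T x = x.shift 1) : ContinuousAt (stripRotation Φ) x := by
  have hcrit : P x ≠ 0 ∨ Q x ≠ 0 := by
    by_contra! hc
    rw [h.map_eq_self_of_critical hc.1 hc.2] at hx
    exact x.ne_shift_one hx
  rw [ContinuousAt, h.stripRotation_eq_one_div hT hx, Metric.tendsto_nhds]
  intro ε hε
  have hev : ∀ᶠ S in 𝓝 T, S ≠ 0 ∧ dist (1 / S) (1 / T) < ε := by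
    refine Filter.Eventually.and (isOpen_ne.mem_nhds hT) (Metric.tendsto_nhds.1 ?_ ε hε)
    exact tendsto_const_nhds.div tendsto_id hT
  obtain ⟨e, he, hball⟩ := Metric.eventually_nhds_iff.1 hev
  obtain ⟨r, hr, hbox⟩ := h.exists_flow_box hcrit he
  have hnear : Tendsto (fun y => (Φ T y).shift ((-1 : ℤ) : ℝ)) (𝓝 x) (𝓝 x) := by
    have := ((Strip.continuous_shift ((-1 : ℤ) : ℝ)).comp (h.continuous_map T)).tendsto x
    rw [Function.comp_apply, hx, Strip.shift_shift, Int.cast_neg, Int.cast_one, add_neg_cancel,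
      Strip.shift_zero] at this
    rw [Int.cast_neg, Int.cast_one]
    exact this
  filter_upwards [Metric.ball_mem_nhds x hr, Metric.tendsto_nhds.1 hnear r hr] with y hy hy'
  obtain ⟨τ, hτ, hτy⟩ := hbox y _ hy hy' (by rw [h.shift_eq, h.energy_eq])
  have hy1 : Φ (T - τ) y = y.shift 1 := by
    have e1 := congrArg (Strip.shift ((1 : ℤ) : ℝ)) hτy
    rw [Strip.shift_shift, ← Int.cast_add, neg_add_cancel, Int.cast_zero, Strip.shift_zero] at e1
    rw [sub_eq_neg_add, h.map_add, ← e1, h.map_shift, ← h.map_add, neg_add_cancel, h.map_zero,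
      Int.cast_one]
  obtain ⟨h0, hd⟩ := hball (y := T - τ) (by rwa [Real.dist_eq, sub_sub_cancel_left, abs_neg])
  rwa [h.stripRotation_eq_one_div h0 hy1]

/-- The rotation number depends continuously on the point. -/
theorem continuous_stripRotation (h : IsStripFlow K F P Q Φ) : Continuous (stripRotation Φ) :=
  continuous_iff_continuousAt.2 fun x => by
    rcases h.stripRotation_eq_zero_or x with h0 | ⟨T, hT, hx, -⟩
    · exact h.continuousAt_stripRotation_of_eq_zero h0
    · exact h.continuousAt_stripRotation_of_map_eq hT hx

end IsStripFlow

/-! ### Integration over one period of the strip -/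

/-- The projection of the plane to the strip. -/
noncomputable def toStrip (x : ℝ × ℝ) : Strip := (x.1, projIcc 0 1 zero_le_one x.2)

theorem toStrip_coe (z : Strip) : toStrip (z.1, (z.2 : ℝ)) = z := by
  simp [toStrip, projIcc_val]

theorem toStrip_snd {x : ℝ × ℝ} (hx : x.2 ∈ Icc (0 : ℝ) 1) : ((toStrip x).2 : ℝ) = x.2 := by
  simp [toStrip, projIcc_of_mem zero_le_one hx]

theorem dist_toStrip_le (x y : ℝ × ℝ) : dist (toStrip x) (toStrip y) ≤ dist x y := by
  rw [Prod.dist_eq, Prod.dist_eq]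
  refine max_le_max le_rfl (((LipschitzWith.projIcc zero_le_one).dist_le_mul _ _).trans ?_)
  simp

theorem continuous_toStrip : Continuous toStrip :=
  (LipschitzWith.of_dist_le_mul (K := 1) fun x y => by simpa using dist_toStrip_le x y).continuous

/-- A fundamental domain of the open strip. -/
def stripBox : Set (ℝ × ℝ) := Ioc 0 1 ×ˢ Ioo 0 1

theorem measurableSet_stripBox : MeasurableSet stripBox := measurableSet_Ioc.prod measurableSet_Ioo

/-- The area of one period of the strip. -/
noncomputable def stripMeasure : Measure Strip := (volume.restrict (Ioc (0 : ℝ) 1)).prod volume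

instance : IsProbabilityMeasure (volume.restrict (Ioc (0 : ℝ) 1)) := ⟨by simp⟩

instance : IsProbabilityMeasure stripMeasure := by
  unfold stripMeasure
  infer_instance

theorem measurePreserving_projIcc :
    MeasurePreserving (projIcc (0 : ℝ) 1 zero_le_one) (volume.restrict (Ioo 0 1)) volume := by
  refine ⟨continuous_projIcc.measurable, ?_⟩
  rw [Measure.restrict_congr_set Ioo_ae_eq_Icc,
    ← map_comap_subtype_coe (measurableSet_Icc : MeasurableSet (Icc (0 : ℝ) 1)),
    Measure.map_map continuous_projIcc.measurable measurable_subtype_coe]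
  have : projIcc (0 : ℝ) 1 zero_le_one ∘ Subtype.val = id := funext fun s => projIcc_val _ s
  rw [this, Measure.map_id]
  rfl

theorem measurePreserving_toStrip :
    MeasurePreserving toStrip (volume.restrict stripBox) stripMeasure := by
  have h := (MeasurePreserving.id (volume.restrict (Ioc (0 : ℝ) 1))).prod measurePreserving_projIcc
  rwa [Measure.prod_restrict] at h

theorem integral_stripMeasure {u : Strip → ℝ} (hu : Continuous u) :
    ∫ z, u z ∂stripMeasure = ∫ x in stripBox, u (toStrip x) := by
  rw [← measurePreserving_toStrip.map_eq,
    integral_map measurePreserving_toStrip.measurable.aemeasurable hu.aestronglyMeasurable]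

theorem abs_integral_stripMeasure_sub_le {u v : Strip → ℝ} (hu : Continuous u)
    (hv : Continuous v) {B B' C : ℝ} (hB : ∀ z, |u z| ≤ B) (hB' : ∀ z, |v z| ≤ B')
    (h : ∀ z, |u z - v z| ≤ C) :
    |∫ z, u z ∂stripMeasure - ∫ z, v z ∂stripMeasure| ≤ C := by
  have hi : ∀ {u : Strip → ℝ} {B : ℝ}, Continuous u → (∀ z, |u z| ≤ B) →
      Integrable u stripMeasure := fun hu hB =>
    Integrable.of_bound hu.aestronglyMeasurable _ (Eventually.of_forall hB)
  rw [← integral_sub (hi hu hB) (hi hv hB')]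
  have := norm_integral_le_of_norm_le_const (μ := stripMeasure) (f := fun z => u z - v z)
    (C := C) (Eventually.of_forall h)
  simpa using this

/-- The integers act on the plane by translations in the direction of `θ`. -/
abbrev thetaTranslations : AddSubgroup (ℝ × ℝ) := AddSubgroup.zmultiples (1, 0)

theorem existsUnique_thetaTranslations {p : ℝ × ℝ → Prop} {x : ℝ × ℝ}
    (h : ∃! n : ℤ, p (n + x.1, x.2)) : ∃! g : thetaTranslations, p (g +ᵥ x) := by
  have hbij : Function.Bijective
      (codRestrict (fun n : ℤ => n • ((1, 0) : ℝ × ℝ)) thetaTranslations fun n => ⟨n, rfl⟩) := by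
    refine ⟨fun m n hmn => ?_, fun ⟨g, n, hn⟩ => ⟨n, Subtype.ext hn⟩⟩
    have := congrArg Prod.fst (congrArg Subtype.val hmn)
    simpa using this
  refine hbij.existsUnique_iff.2 ?_
  convert h using 3 with n
  simp only [AddSubgroup.vadd_def, vadd_eq_add]
  ext <;> simp

/-- A periodic function has the same integral over all measurable fundamental domains of the open
strip. -/
theorem setIntegral_eq_of_fundamental {v : ℝ × ℝ → ℝ} (hv : ∀ (n : ℤ) x, v (n + x.1, x.2) = v x)
    {D : Set (ℝ × ℝ)} (hD : MeasurableSet D) (hDU : ∀ x ∈ D, x.2 ∈ Ioo (0 : ℝ) 1)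
    (hex : ∀ x : ℝ × ℝ, x.2 ∈ Ioo (0 : ℝ) 1 → ∃! n : ℤ, ((n + x.1, x.2) : ℝ × ℝ) ∈ D) :
    ∫ x in D, v x = ∫ x in stripBox, v x := by
  set U : Set (ℝ × ℝ) := univ ×ˢ Ioo 0 1 with hU
  have hUm : MeasurableSet U := MeasurableSet.univ.prod measurableSet_Ioo
  set E : Set (ℝ × ℝ) := Ioc 0 1 ×ˢ univ with hE
  have hEm : MeasurableSet E := measurableSet_Ioc.prod MeasurableSet.univ
  have hEex : ∀ x : ℝ × ℝ, ∃! n : ℤ, ((n + x.1, x.2) : ℝ × ℝ) ∈ E := fun x => by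
    have := existsUnique_add_zsmul_mem_Ioc one_pos x.1 0
    simpa [hE, add_comm] using this
  have h1 : IsAddFundamentalDomain thetaTranslations E volume :=
    IsAddFundamentalDomain.mk' hEm.nullMeasurableSet fun x =>
      existsUnique_thetaTranslations (p := (· ∈ E)) (hEex x)
  -- Outside the open strip `D` is completed by the standard domain `E`, so that both are
  -- fundamental domains of the whole plane. The indicator of `U` then discards what was added.
  have h2 : IsAddFundamentalDomain thetaTranslations (D ∪ E \ U) volume := by
    refine IsAddFundamentalDomain.mk' (hD.union (hEm.diff hUm)).nullMeasurableSet fun x =>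
      existsUnique_thetaTranslations (p := (· ∈ D ∪ E \ U)) ?_
    by_cases hx : x.2 ∈ Ioo (0 : ℝ) 1
    · refine (existsUnique_congr fun n => ?_).2 (hex x hx)
      exact ⟨fun h => h.resolve_right fun h => h.2 ⟨mem_univ _, hx⟩, Or.inl⟩
    · refine (existsUnique_congr fun n => ?_).2 (hEex x)
      exact ⟨fun h => (h.resolve_left fun h => hx (hDU ((n : ℝ) + x.1, x.2) h)).1,
        fun h => Or.inr ⟨h, fun h => hx h.2⟩⟩
  have hind : ∀ (g : thetaTranslations) (x : ℝ × ℝ),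
      U.indicator v (g +ᵥ x) = U.indicator v x := by
    rintro ⟨g, n, hn⟩ x
    have e : ((⟨g, n, hn⟩ : thetaTranslations) +ᵥ x) = (n + x.1, x.2) := by
      subst hn
      simp only [AddSubgroup.vadd_def, vadd_eq_add]
      ext <;> simp
    rw [e]
    by_cases hx : x.2 ∈ Ioo (0 : ℝ) 1
    · rw [indicator_of_mem (show ((n : ℝ) + x.1, x.2) ∈ U from ⟨mem_univ _, hx⟩),
        indicator_of_mem (show x ∈ U from ⟨mem_univ _, hx⟩), hv]
    · rw [indicator_of_notMem fun h : ((n : ℝ) + x.1, x.2) ∈ U => hx h.2,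
        indicator_of_notMem fun h : x ∈ U => hx h.2]
  have key := h2.setIntegral_eq h1 hind
  rw [setIntegral_indicator hUm, setIntegral_indicator hUm] at key
  have e1 : (D ∪ E \ U) ∩ U = D := by
    ext x
    constructor
    · rintro ⟨h | h, hx⟩
      · exact h
      · exact absurd hx h.2
    · exact fun h => ⟨Or.inl h, mem_univ _, hDU x h⟩
  have e2 : E ∩ U = stripBox := by
    ext x
    simp [hE, hU, stripBox]
  rwa [e1, e2] at key

/-! ### Euler steps and Liouville's theorem -/

/-- On the open strip, `P` and `Q` are the partial derivatives of a function with bounded second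
derivatives `Q_θ = P_s = a`, `Q_s = b`, `P_θ = c`. -/
def HasSymmetricHessian (K : NNReal) (P Q : Strip → ℝ) : Prop :=
  ∀ x : ℝ × ℝ, x.2 ∈ Ioo (0 : ℝ) 1 → ∃ a b c : ℝ, |a| ≤ K ∧ |b| ≤ K ∧ |c| ≤ K ∧
    HasFDerivAt (fun y => Q (toStrip y))
      (a • ContinuousLinearMap.fst ℝ ℝ ℝ + b • ContinuousLinearMap.snd ℝ ℝ ℝ) x ∧
    HasFDerivAt (fun y => P (toStrip y))
      (c • ContinuousLinearMap.fst ℝ ℝ ℝ + a • ContinuousLinearMap.snd ℝ ℝ ℝ) x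

theorem det_prod_continuousLinearMap (a b c d : ℝ) :
    ((a • ContinuousLinearMap.fst ℝ ℝ ℝ + b • ContinuousLinearMap.snd ℝ ℝ ℝ).prod
      (c • ContinuousLinearMap.fst ℝ ℝ ℝ + d • ContinuousLinearMap.snd ℝ ℝ ℝ)).det =
      a * d - b * c := by
  rw [ContinuousLinearMap.det]
  have : (((a • ContinuousLinearMap.fst ℝ ℝ ℝ + b • ContinuousLinearMap.snd ℝ ℝ ℝ).prod
      (c • ContinuousLinearMap.fst ℝ ℝ ℝ + d • ContinuousLinearMap.snd ℝ ℝ ℝ) :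
        ℝ × ℝ →L[ℝ] ℝ × ℝ) : ℝ × ℝ →ₗ[ℝ] ℝ × ℝ) =
      Matrix.toLin (Module.Basis.finTwoProd ℝ) (Module.Basis.finTwoProd ℝ) !![a, b; c, d] := by
    rw [Matrix.toLin_finTwoProd]
    rfl
  rw [this, LinearMap.det_toLin, Matrix.det_fin_two_of]

/-- One step of the Euler method for `θ' = Q`, `s' = -P`. -/
noncomputable def eulerStep (P Q : Strip → ℝ) (h : ℝ) (x : ℝ × ℝ) : ℝ × ℝ :=
  (x.1 + h * Q (toStrip x), x.2 + -(h * P (toStrip x)))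

theorem toStrip_add_int (n : ℤ) (x : ℝ × ℝ) :
    toStrip ((n : ℝ) + x.1, x.2) = (toStrip x).shift n :=
  Prod.ext (add_comm _ _) rfl

namespace IsStripGradient

variable {K : NNReal} {F P Q : Strip → ℝ}

theorem dist_comp_toStrip_le {R : Strip → ℝ} (hR : LipschitzWith K R) {h : ℝ} (hh : 0 ≤ h)
    (x y : ℝ × ℝ) : |h * R (toStrip x) - h * R (toStrip y)| ≤ h * K * dist x y := by
  rw [← mul_sub, abs_mul, abs_of_nonneg hh, mul_assoc]
  exact mul_le_mul_of_nonneg_left ((hR.dist_le_mul _ _).trans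
    (mul_le_mul_of_nonneg_left (dist_toStrip_le x y) K.2)) hh

theorem injective_eulerStep (g : IsStripGradient K F P Q) {h : ℝ} (hh : 0 ≤ h) (hK : h * K < 1) :
    Function.Injective (eulerStep P Q h) := by
  intro x y hxy
  have h1 := dist_comp_toStrip_le g.lipschitz_s hh x y
  have h2 := dist_comp_toStrip_le g.lipschitz_theta hh x y
  have e1 : x.1 - y.1 = -(h * Q (toStrip x) - h * Q (toStrip y)) := by
    have := congrArg Prod.fst hxy
    simp only [eulerStep] at this
    linarith
  have e2 : x.2 - y.2 = h * P (toStrip x) - h * P (toStrip y) := by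
    have := congrArg Prod.snd hxy
    simp only [eulerStep] at this
    linarith
  have hd : dist x y ≤ h * K * dist x y := by
    nth_rewrite 1 [Prod.dist_eq]
    rw [Real.dist_eq, Real.dist_eq, e1, e2, abs_neg]
    exact max_le h1 h2
  have : dist x y ≤ 0 := by
    by_contra! hpos
    exact absurd hd (not_le.2 (mul_lt_of_lt_one_left hpos hK))
  exact dist_le_zero.1 this

theorem abs_theta_le_dist_bot (g : IsStripGradient K F P Q) (z : Strip) :
    |P z| ≤ K * (z.2 : ℝ) := by
  have := g.lipschitz_theta.dist_le_mul z (z.1, 0)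
  rw [g.theta_bot, dist_zero_right, Prod.dist_eq, dist_self, max_eq_right dist_nonneg,
    Subtype.dist_eq, Real.dist_eq] at this
  simpa [abs_of_nonneg z.2.2.1] using this

theorem abs_theta_le_dist_top (g : IsStripGradient K F P Q) (z : Strip) :
    |P z| ≤ K * (1 - (z.2 : ℝ)) := by
  have := g.lipschitz_theta.dist_le_mul z (z.1, 1)
  rw [g.theta_top, dist_zero_right, Prod.dist_eq, dist_self, max_eq_right dist_nonneg,
    dist_comm, Subtype.dist_eq, Real.dist_eq] at this
  simpa [abs_of_nonneg (sub_nonneg.2 z.2.2.2)] using this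

/-- `P` vanishes on the boundary and is `K`-Lipschitz, so a step changes the height by at most `h *
K` times the distance to either boundary line, and `h * K < 1`. -/
theorem eulerStep_snd_mem (g : IsStripGradient K F P Q) {h : ℝ} (hh : 0 ≤ h) (hK : h * K < 1)
    {x : ℝ × ℝ} (hx : x.2 ∈ Ioo (0 : ℝ) 1) : (eulerStep P Q h x).2 ∈ Ioo (0 : ℝ) 1 := by
  have h1 := abs_le.1 (g.abs_theta_le_dist_bot (toStrip x))
  have h2 := abs_le.1 (g.abs_theta_le_dist_top (toStrip x))
  rw [toStrip_snd (Ioo_subset_Icc_self hx)] at h1 h2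
  have h3 := mul_le_mul_of_nonneg_left h1.2 hh
  have h4 := mul_le_mul_of_nonneg_left h2.1 hh
  have h5 : h * K * x.2 < x.2 := mul_lt_of_lt_one_left hx.1 hK
  have h6 : h * K * (1 - x.2) < 1 - x.2 := mul_lt_of_lt_one_left (sub_pos.2 hx.2) hK
  simp only [eulerStep]
  constructor <;> linarith

/-- The preimage is the fixed point of a contraction of the plane. It lies in the open strip: beyond
the boundary `toStrip` projects to a point with `P = 0`, so the step would not change the height. -/
theorem exists_eulerStep_eq (g : IsStripGradient K F P Q) {h : ℝ} (hh : 0 ≤ h) (hK : h * K < 1)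
    {y : ℝ × ℝ} (hy : y.2 ∈ Ioo (0 : ℝ) 1) :
    ∃ x : ℝ × ℝ, x.2 ∈ Ioo (0 : ℝ) 1 ∧ eulerStep P Q h x = y := by
  set T : ℝ × ℝ → ℝ × ℝ := fun x => (y.1 - h * Q (toStrip x), y.2 + h * P (toStrip x)) with hT
  have hhK : 0 ≤ h * K := mul_nonneg hh K.2
  have hcontr : ContractingWith ⟨h * K, hhK⟩ T := by
    refine ⟨by exact_mod_cast hK, LipschitzWith.of_dist_le_mul fun x x' => ?_⟩
    rw [Prod.dist_eq, Real.dist_eq, Real.dist_eq]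
    refine max_le ?_ ?_
    · simp only [hT, sub_sub_sub_cancel_left]
      rw [abs_sub_comm]
      exact dist_comp_toStrip_le g.lipschitz_s hh x x'
    · simp only [hT, add_sub_add_left_eq_sub]
      exact dist_comp_toStrip_le g.lipschitz_theta hh x x'
  obtain ⟨x, hx⟩ : ∃ x, T x = x := ⟨_, hcontr.fixedPoint_isFixedPt⟩
  have e1 := congrArg Prod.fst hx
  have e2 := congrArg Prod.snd hx
  simp only [hT] at e1 e2
  refine ⟨x, ⟨?_, ?_⟩, Prod.ext ?_ ?_⟩
  · by_contra! hle
    have : toStrip x = (x.1, 0) := by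
      simp only [toStrip, projIcc_of_le_left zero_le_one hle]
      rfl
    rw [this, g.theta_bot, mul_zero, add_zero] at e2
    linarith [hy.1]
  · by_contra! hle
    have : toStrip x = (x.1, 1) := by
      simp only [toStrip, projIcc_of_right_le zero_le_one hle]
      rfl
    rw [this, g.theta_top, mul_zero, add_zero] at e2
    linarith [hy.2]
  · simp only [eulerStep]
    linarith
  · simp only [eulerStep]
    linarith

theorem eulerStep_add_int (g : IsStripGradient K F P Q) (h : ℝ) (n : ℤ) (x : ℝ × ℝ) :
    eulerStep P Q h ((n : ℝ) + x.1, x.2) =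
      ((n : ℝ) + (eulerStep P Q h x).1, (eulerStep P Q h x).2) := by
  simp only [eulerStep, toStrip_add_int, g.s_shift, g.theta_shift, add_assoc]

theorem continuous_eulerStep (g : IsStripGradient K F P Q) (h : ℝ) :
    Continuous (eulerStep P Q h) := by
  have h1 := g.lipschitz_theta.continuous.comp continuous_toStrip
  have h2 := g.lipschitz_s.continuous.comp continuous_toStrip
  exact (continuous_fst.add (continuous_const.mul h2)).prodMk
    (continuous_snd.add (continuous_const.mul h1).neg)

/-- The Euler step maps a fundamental domain of the open strip to a fundamental domain. -/
theorem setIntegral_image_eulerStep (g : IsStripGradient K F P Q) {h : ℝ} (hh : 0 ≤ h)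
    (hK : h * K < 1) {v : ℝ × ℝ → ℝ} (hv : ∀ (n : ℤ) x, v (n + x.1, x.2) = v x) :
    ∫ x in eulerStep P Q h '' stripBox, v x = ∫ x in stripBox, v x := by
  have hinj := g.injective_eulerStep hh hK
  refine setIntegral_eq_of_fundamental hv
    (measurableSet_stripBox.image_of_continuousOn_injOn (g.continuous_eulerStep h).continuousOn
      hinj.injOn) ?_ ?_
  · rintro _ ⟨x, hx, rfl⟩
    exact g.eulerStep_snd_mem hh hK hx.2
  · intro y hy
    obtain ⟨x, hx, rfl⟩ := g.exists_eulerStep_eq hh hK hy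
    have := existsUnique_add_zsmul_mem_Ioc one_pos x.1 0
    refine (existsUnique_congr fun n => ?_).2 this
    rw [← g.eulerStep_add_int, hinj.mem_set_image]
    simp only [stripBox, mem_prod, hx, and_true, zsmul_eq_mul, mul_one, zero_add, add_comm x.1]

/-- The Euler step preserves the area up to an error of order two. -/
theorem abs_integral_eulerStep_sub_le (g : IsStripGradient K F P Q)
    (hs : HasSymmetricHessian K P Q) {h : ℝ} (hh : 0 ≤ h) (hK : h * K < 1) {u : Strip → ℝ}
    (hu : Continuous u) (hper : ∀ (n : ℤ) z, u (z.shift n) = u z) {B : ℝ} (hB : ∀ z, |u z| ≤ B) :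
    |(∫ x in stripBox, u (toStrip (eulerStep P Q h x))) - ∫ z, u z ∂stripMeasure| ≤
      2 * K ^ 2 * B * h ^ 2 := by
  choose! a b c ha hb hc hQ hP using hs
  set D : ℝ × ℝ → ℝ × ℝ →L[ℝ] ℝ × ℝ := fun x =>
    ((1 + h * a x) • ContinuousLinearMap.fst ℝ ℝ ℝ +
      (h * b x) • ContinuousLinearMap.snd ℝ ℝ ℝ).prod
    ((-(h * c x)) • ContinuousLinearMap.fst ℝ ℝ ℝ +
      (1 - h * a x) • ContinuousLinearMap.snd ℝ ℝ ℝ) with hD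
  have hder : ∀ x ∈ stripBox, HasFDerivWithinAt (eulerStep P Q h) (D x) stripBox x := by
    intro x hx
    have h1 : HasFDerivAt (eulerStep P Q h) _ x :=
      (hasFDerivAt_fst.add ((hQ x hx.2).const_mul h)).prodMk
      (hasFDerivAt_snd.add ((hP x hx.2).const_mul h).neg)
    refine (h1.congr_fderiv ?_).hasFDerivWithinAt
    ext <;> simp [hD]
    ring
  -- The mixed derivatives agree, so the terms of first order in `h` cancel and the determinant is
  -- `1 + h ^ 2 * (b c - a ^ 2)`.
  have hdet : ∀ x ∈ stripBox, |(|(D x).det|) - 1| ≤ 2 * K ^ 2 * h ^ 2 := by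
    intro x hx
    refine (abs_abs_sub_abs_le (D x).det 1 |>.trans_eq' (by rw [abs_one])).trans ?_
    rw [hD, det_prod_continuousLinearMap]
    have e : (1 + h * a x) * (1 - h * a x) - h * b x * -(h * c x) - 1 =
        h ^ 2 * (b x * c x - a x * a x) := by ring
    rw [e, abs_mul, abs_of_nonneg (sq_nonneg h)]
    have h1 : |a x * a x| ≤ K * K := by
      rw [abs_mul]
      exact mul_le_mul (ha x hx.2) (ha x hx.2) (abs_nonneg _) K.2
    have h2 : |b x * c x| ≤ K * K := by
      rw [abs_mul]
      exact mul_le_mul (hb x hx.2) (hc x hx.2) (abs_nonneg _) K.2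
    have h3 := (abs_sub (b x * c x) (a x * a x)).trans (add_le_add h2 h1)
    calc h ^ 2 * |b x * c x - a x * a x| ≤ h ^ 2 * (K * K + K * K) :=
          mul_le_mul_of_nonneg_left h3 (sq_nonneg h)
      _ = 2 * K ^ 2 * h ^ 2 := by ring
  have hinj : InjOn (eulerStep P Q h) stripBox := (g.injective_eulerStep hh hK).injOn
  have hfin : volume stripBox = 1 := by
    rw [stripBox, Measure.volume_eq_prod, Measure.prod_prod]
    simp
  set v : ℝ × ℝ → ℝ := fun x => u (toStrip x) with hv
  have hvc : Continuous v := hu.comp continuous_toStrip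
  have hint : ∀ {w : ℝ × ℝ → ℝ} {s : Set (ℝ × ℝ)}, volume s ≠ ⊤ → Continuous w →
      (∀ x, |w x| ≤ B) → IntegrableOn w s := fun hs hw hwB =>
    Measure.integrableOn_of_bounded hs hw.aestronglyMeasurable (Eventually.of_forall hwB)
  have himage : volume (eulerStep P Q h '' stripBox) ≠ ⊤ := by
    have := lintegral_abs_det_fderiv_eq_addHaar_image volume measurableSet_stripBox hder hinj
    rw [← this]
    refine ne_top_of_le_ne_top (b := ENNReal.ofReal (1 + 2 * K ^ 2 * h ^ 2) * volume stripBox)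
      (by rw [hfin]; simp) ?_
    refine (setLIntegral_mono_ae aemeasurable_const (Eventually.of_forall fun x hx =>
      ENNReal.ofReal_le_ofReal ?_)).trans_eq (setLIntegral_const _ _)
    have := (abs_le.1 (hdet x hx)).2
    linarith
  have hcv := integral_image_eq_integral_abs_det_fderiv_smul volume measurableSet_stripBox hder
    hinj v
  have hvper : ∀ (n : ℤ) x, v (n + x.1, x.2) = v x := fun n x => by
    simp only [hv, toStrip_add_int, hper]
  rw [g.setIntegral_image_eulerStep hh hK hvper] at hcv
  have hi1 : IntegrableOn (fun x => |(D x).det| • v (eulerStep P Q h x)) stripBox :=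
    (integrableOn_image_iff_integrableOn_abs_det_fderiv_smul volume measurableSet_stripBox hder
      hinj v).1 (hint himage hvc fun x => hB _)
  have hi2 : IntegrableOn (fun x => v (eulerStep P Q h x)) stripBox :=
    hint (by rw [hfin]; simp) (hvc.comp (g.continuous_eulerStep h)) fun x => hB _
  rw [integral_stripMeasure hu, hcv]
  change |(∫ x in stripBox, v (eulerStep P Q h x)) - _| ≤ _
  rw [← integral_sub hi2 hi1]
  have hbound := norm_setIntegral_le_of_norm_le_const (μ := volume) (s := stripBox)
    (f := fun x => v (eulerStep P Q h x) - |(D x).det| • v (eulerStep P Q h x))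
    (C := 2 * K ^ 2 * h ^ 2 * B) (by rw [hfin]; simp) (fun x hx => by
      rw [smul_eq_mul, ← one_sub_mul, norm_mul, Real.norm_eq_abs, abs_sub_comm]
      exact mul_le_mul (hdet x hx) (hB _) (norm_nonneg _) (by positivity))
  rw [measureReal_def, hfin, ENNReal.toReal_one, mul_one, Real.norm_eq_abs] at hbound
  exact hbound.trans_eq (by ring)

end IsStripGradient

theorem abs_sub_mul_le_of_deriv {f f' : ℝ → ℝ} {C : ℝ} (hC : 0 ≤ C)
    (hf : ∀ t, HasDerivAt f (f' t) t) (hf' : ∀ t, |f' t - f' 0| ≤ C * |t|) {h : ℝ} (hh : 0 ≤ h) :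
    |f h - f 0 - h * f' 0| ≤ C * h ^ 2 := by
  have := (convex_Icc 0 h).norm_image_sub_le_of_norm_hasDerivWithin_le
    (f := fun t => f t - t * f' 0) (f' := fun t => f' t - 1 * f' 0) (C := C * h)
    (fun t _ => ((hf t).sub ((hasDerivAt_id t).mul_const _)).hasDerivWithinAt)
    (fun t ht => by
      rw [one_mul]
      refine (hf' t).trans ?_
      rw [abs_of_nonneg ht.1]
      exact mul_le_mul_of_nonneg_left ht.2 hC)
    (left_mem_Icc.2 hh) (right_mem_Icc.2 hh)
  rw [Real.norm_eq_abs, Real.norm_eq_abs, sub_zero, abs_of_nonneg hh] at this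
  refine le_trans (le_of_eq ?_) (this.trans_eq (by ring))
  congr 1
  ring

namespace IsStripFlow

variable {K : NNReal} {F P Q : Strip → ℝ} {Φ : ℝ → Strip → Strip}

theorem abs_fst_sub_le (h : IsStripFlow K F P Q Φ) (z : Strip) {t : ℝ} (ht : 0 ≤ t) :
    |(Φ t z).1 - z.1 - t * Q z| ≤ K * K * t ^ 2 := by
  have := abs_sub_mul_le_of_deriv (C := K * K) (by positivity) (h.hasDerivAt_fst z) (fun t => by
    refine (h.lipschitz_s.dist_le_mul _ _).trans ?_
    rw [mul_assoc]
    refine mul_le_mul_of_nonneg_left ?_ K.2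
    simpa using h.dist_time_le z t 0) ht
  rwa [h.map_zero] at this

theorem abs_snd_sub_le (h : IsStripFlow K F P Q Φ) (z : Strip) {t : ℝ} (ht : 0 ≤ t) :
    |((Φ t z).2 : ℝ) - z.2 - t * -P z| ≤ K * K * t ^ 2 := by
  have := abs_sub_mul_le_of_deriv (C := K * K) (by positivity) (h.hasDerivAt_snd z) (fun t => by
    rw [neg_sub_neg, abs_sub_comm]
    refine (h.lipschitz_theta.dist_le_mul _ _).trans ?_
    rw [mul_assoc]
    refine mul_le_mul_of_nonneg_left ?_ K.2
    simpa using h.dist_time_le z t 0) ht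
  rwa [h.map_zero] at this

theorem dist_eulerStep_le (h : IsStripFlow K F P Q Φ) {t : ℝ} (ht : 0 ≤ t) {x : ℝ × ℝ}
    (hx : x.2 ∈ Icc (0 : ℝ) 1) :
    dist (Φ t (toStrip x)) (toStrip (eulerStep P Q t x)) ≤ K * K * t ^ 2 := by
  set z := toStrip x with hz
  have h1 := h.abs_fst_sub_le z ht
  have h2 := h.abs_snd_sub_le z ht
  rw [← toStrip_coe (Φ t z)]
  refine (dist_toStrip_le _ _).trans ?_
  rw [Prod.dist_eq, Real.dist_eq, Real.dist_eq]
  refine max_le (le_trans (le_of_eq ?_) h1) (le_trans (le_of_eq ?_) h2)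
  · congr 1
    simp only [eulerStep, hz, toStrip]
    ring
  · congr 1
    rw [hz, toStrip_snd hx]
    simp only [eulerStep]
    ring

/-- Two errors of order `t ^ 2`: the distance from the flow to its Euler step, seen through the
Lipschitz function `u`, and the change of area under the Euler step. The flow itself is never
differentiated in the initial condition. -/
theorem abs_integral_map_sub_le (h : IsStripFlow K F P Q Φ) (hs : HasSymmetricHessian K P Q)
    {t : ℝ} (ht : 0 ≤ t) (hK : t * K < 1) {u : Strip → ℝ} {L : NNReal} (hu : LipschitzWith L u)
    (hper : ∀ (n : ℤ) z, u (z.shift n) = u z) {B : ℝ} (hB : ∀ z, |u z| ≤ B) :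
    |∫ z, u (Φ t z) ∂stripMeasure - ∫ z, u z ∂stripMeasure| ≤
      (L * (K * K) + 2 * K ^ 2 * B) * t ^ 2 := by
  have h1 := h.toIsStripGradient.abs_integral_eulerStep_sub_le hs ht hK hu.continuous hper hB
  have hfin : volume stripBox = 1 := by
    rw [stripBox, Measure.volume_eq_prod, Measure.prod_prod]
    simp
  have hint : ∀ {w : ℝ × ℝ → ℝ}, Continuous w → (∀ x, |w x| ≤ B) →
      IntegrableOn w stripBox := fun hw hwB =>
    Measure.integrableOn_of_bounded (by rw [hfin]; simp) hw.aestronglyMeasurable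
      (Eventually.of_forall hwB)
  have hc1 : Continuous fun z => u (Φ t z) := hu.continuous.comp (h.continuous_map t)
  have h2 : |∫ z, u (Φ t z) ∂stripMeasure - ∫ x in stripBox, u (toStrip (eulerStep P Q t x))| ≤
      L * (K * K * t ^ 2) := by
    have hi1 : IntegrableOn (fun x => u (Φ t (toStrip x))) stripBox :=
      hint (hc1.comp continuous_toStrip) fun x => hB _
    have hi2 : IntegrableOn (fun x => u (toStrip (eulerStep P Q t x))) stripBox :=
      hint (hu.continuous.comp (continuous_toStrip.comp
        (h.toIsStripGradient.continuous_eulerStep t))) fun x => hB _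
    rw [integral_stripMeasure hc1, ← integral_sub hi1 hi2]
    have := norm_setIntegral_le_of_norm_le_const (μ := volume) (s := stripBox)
      (f := fun x => u (Φ t (toStrip x)) - u (toStrip (eulerStep P Q t x)))
      (C := L * (K * K * t ^ 2)) (by rw [hfin]; simp) (fun x hx =>
        (hu.dist_le_mul _ _).trans (mul_le_mul_of_nonneg_left
          (h.dist_eulerStep_le ht (Ioo_subset_Icc_self hx.2)) L.2))
    rw [measureReal_def, hfin, ENNReal.toReal_one, mul_one] at this
    exact this
  refine (abs_sub_le _ (∫ x in stripBox, u (toStrip (eulerStep P Q t x))) _).trans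
    ((add_le_add h2 h1).trans_eq ?_)
  ring

/-- Liouville's theorem: the flow preserves the area. -/
theorem integral_map_eq (h : IsStripFlow K F P Q Φ) (hs : HasSymmetricHessian K P Q)
    {t : ℝ} (ht : 0 ≤ t) {u : Strip → ℝ} {L : NNReal} (hu : LipschitzWith L u)
    (hper : ∀ (n : ℤ) z, u (z.shift n) = u z) {B : ℝ} (hB : ∀ z, |u z| ≤ B) :
    ∫ z, u (Φ t z) ∂stripMeasure = ∫ z, u z ∂stripMeasure := by
  have hB0 : 0 ≤ B := (abs_nonneg _).trans (hB (0, 0))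
  set E : NNReal := ⟨Real.exp (K * t), Real.exp_nonneg _⟩ with hE
  set C : ℝ := (((L * E : NNReal) : ℝ) * (K * K) + 2 * K ^ 2 * B) * t ^ 2 with hC
  -- The functions `u ∘ Φ s` with `0 ≤ s ≤ t` share the Lipschitz constant `L * E`, so each of `N`
  -- steps of length `t / N` costs `O(1 / N ^ 2)`, and their sum tends to zero.
  have hstep : ∀ (h' : ℝ), 0 ≤ h' → h' * K < 1 → ∀ s ∈ Icc 0 t,
      |∫ z, u (Φ (s + h') z) ∂stripMeasure - ∫ z, u (Φ s z) ∂stripMeasure| ≤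
      (((L * E : NNReal) : ℝ) * (K * K) + 2 * K ^ 2 * B) * h' ^ 2 := by
    intro h' hh' hK s hs'
    have hl : LipschitzWith (L * E) (fun z => u (Φ s z)) :=
      hu.comp (LipschitzWith.of_dist_le_mul fun z w => by
        rw [mul_comm]
        refine (h.dist_map_le s z w).trans (mul_le_mul_of_nonneg_left ?_ dist_nonneg)
        exact Real.exp_le_exp.2 (mul_le_mul_of_nonneg_left
          (by rw [abs_of_nonneg hs'.1]; exact hs'.2) K.2))
    have := h.abs_integral_map_sub_le hs hh' hK hl
      (fun n z => by simp only [h.map_shift, hper]) (fun z => hB _)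
    simpa only [← h.map_add] using this
  have hle : ∀ᶠ N : ℕ in atTop,
      |∫ z, u (Φ t z) ∂stripMeasure - ∫ z, u z ∂stripMeasure| ≤ C * (1 / (N : ℝ)) := by
    obtain ⟨M, hM⟩ := exists_nat_gt (t * K)
    filter_upwards [eventually_ge_atTop (max M 1)] with N hN
    have hN1 : (0 : ℝ) < N := by
      exact_mod_cast (le_max_right M 1).trans hN
    have hNM : (M : ℝ) ≤ N := by
      exact_mod_cast (le_max_left M 1).trans hN
    have hsum : ∫ z, u (Φ t z) ∂stripMeasure - ∫ z, u z ∂stripMeasure =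
        ∑ k ∈ Finset.range N, (∫ z, u (Φ (k * (t / N) + t / N) z) ∂stripMeasure -
          ∫ z, u (Φ (k * (t / N)) z) ∂stripMeasure) := by
      have := Finset.sum_range_sub (fun k : ℕ => ∫ z, u (Φ (k * (t / N)) z) ∂stripMeasure) N
      simp only [Nat.cast_add, Nat.cast_one, add_mul, one_mul, Nat.cast_zero, zero_mul,
        h.map_zero] at this
      rw [this, mul_div_cancel₀ _ hN1.ne']
    rw [hsum]
    refine (Finset.abs_sum_le_sum_abs _ _).trans
      ((Finset.sum_le_sum fun (k : ℕ) hk =>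
        hstep (t / N) (by positivity) ?_ ((k : ℝ) * (t / N)) ?_).trans ?_)
    · rw [div_mul_eq_mul_div, div_lt_one hN1]
      linarith
    · have hk' : (k : ℝ) ≤ N := by exact_mod_cast (Finset.mem_range.1 hk).le
      refine ⟨by positivity, ?_⟩
      rw [mul_div_left_comm]
      exact mul_le_of_le_one_right ht ((div_le_one hN1).2 hk')
    · rw [Finset.sum_const, Finset.card_range, nsmul_eq_mul, hC]
      refine le_of_eq ?_
      field_simp
  have hlim := (tendsto_one_div_atTop_nhds_zero_nat (𝕜 := ℝ)).const_mul C
  rw [mul_zero] at hlim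
  exact sub_eq_zero.1 (abs_nonpos_iff.1 (ge_of_tendsto hlim hle))

/-! ### The mean rotation number -/

theorem abs_stripRotation_le (h : IsStripFlow K F P Q Φ) (z : Strip) :
    |stripRotation Φ z| ≤ K := by
  refine le_of_tendsto (h.tendsto_stripRotation z).abs ?_
  filter_upwards [eventually_gt_atTop 0] with t ht
  rw [abs_div, div_le_iff₀ (abs_pos.2 ht.ne')]
  have := h.dist_time_le z t 0
  rw [h.map_zero, sub_zero, Strip.dist_eq] at this
  exact (le_max_left _ _).trans this

/-- The mean of the displacement in the direction of `θ` is proportional to time. -/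
theorem integral_displacement_mul (h : IsStripFlow K F P Q Φ) (hs : HasSymmetricHessian K P Q)
    {t : ℝ} (ht : 0 ≤ t) (n : ℕ) :
    ∫ z, ((Φ (n * t) z).1 - z.1) ∂stripMeasure = n * ∫ z, ((Φ t z).1 - z.1) ∂stripMeasure := by
  set d : Strip → ℝ := fun z => (Φ t z).1 - z.1 with hd
  have hdl : LipschitzWith (1 * ⟨Real.exp (K * |t|), Real.exp_nonneg _⟩ + 1) d := by
    refine (LipschitzWith.prod_fst.comp (LipschitzWith.of_dist_le_mul fun z w => ?_)).sub
      LipschitzWith.prod_fst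
    rw [mul_comm]
    exact h.dist_map_le t z w
  have hdper : ∀ (n : ℤ) z, d (z.shift n) = d z := fun n z => by
    simp only [hd, h.map_shift, Strip.shift_fst, add_sub_add_right_eq_sub]
  have hdB : ∀ t z, |(Φ t z).1 - z.1| ≤ K * |t| := fun t z => by
    have := h.dist_time_le z t 0
    rw [h.map_zero, sub_zero, Strip.dist_eq] at this
    exact (le_max_left _ _).trans this
  have hint : ∀ {u : Strip → ℝ} {B : ℝ}, Continuous u → (∀ z, |u z| ≤ B) →
      Integrable u stripMeasure := fun hu hB =>
    Integrable.of_bound hu.aestronglyMeasurable _ (Eventually.of_forall hB)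
  have hcont : ∀ t, Continuous fun z : Strip => (Φ t z).1 - z.1 := fun t =>
    (continuous_fst.comp (h.continuous_map t)).sub continuous_fst
  induction n with
  | zero => simp [h.map_zero]
  | succ n ih =>
    -- The displacement is a cocycle over the flow; the mean of its new term is unchanged by
    -- Liouville's theorem.
    have e : ∀ z, (Φ ((n + 1 : ℕ) * t) z).1 - z.1 =
        d (Φ (n * t) z) + ((Φ (n * t) z).1 - z.1) := fun z => by
      simp only [hd]
      rw [← h.map_add, Nat.cast_succ, add_mul, one_mul, add_comm t]
      ring
    have hi : Integrable (fun z => d (Φ (n * t) z)) stripMeasure :=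
      hint (hdl.continuous.comp (h.continuous_map _)) fun z => hdB t _
    simp only [e]
    rw [integral_add hi (hint (hcont _) fun z => hdB _ z), ih,
      h.integral_map_eq hs (by positivity) hdl hdper (hdB t)]
    push_cast
    ring

/-- The mean of the displacement in time `n t`, divided by `n t`, does not depend on `n > 0`. As `n`
grows it tends to the mean rotation number, by dominated convergence with the speed bound `K`. -/
theorem integral_stripRotation_mul (h : IsStripFlow K F P Q Φ) (hs : HasSymmetricHessian K P Q)
    {t : ℝ} (ht : 0 < t) :
    (∫ z, stripRotation Φ z ∂stripMeasure) * t = ∫ z, ((Φ t z).1 - z.1) ∂stripMeasure := by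
  have hlim : Tendsto (fun n : ℕ => ∫ z, ((Φ (n * t) z).1 - z.1) / (n * t) ∂stripMeasure) atTop
      (𝓝 (∫ z, stripRotation Φ z ∂stripMeasure)) := by
    refine tendsto_integral_of_dominated_convergence (fun _ => (K : ℝ)) (fun n => ?_)
      (integrable_const _) (fun n => Eventually.of_forall fun z => ?_)
      (Eventually.of_forall fun z => ?_)
    · exact (((continuous_fst.comp (h.continuous_map _)).sub continuous_fst).div_const
        _).aestronglyMeasurable
    · rw [norm_div]
      refine div_le_of_le_mul₀ (norm_nonneg _) K.2 ?_
      have := h.dist_time_le z (n * t) 0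
      rw [h.map_zero, sub_zero, Strip.dist_eq] at this
      exact (le_max_left _ _).trans this
    · exact (h.tendsto_stripRotation z).comp
        (tendsto_natCast_atTop_atTop.atTop_mul_const ht)
  have hconst : Tendsto (fun n : ℕ => ∫ z, ((Φ (n * t) z).1 - z.1) / (n * t) ∂stripMeasure) atTop
      (𝓝 ((∫ z, ((Φ t z).1 - z.1) ∂stripMeasure) / t)) := by
    refine tendsto_const_nhds.congr' ?_
    filter_upwards [eventually_gt_atTop 0] with n hn
    have hn' : (n : ℝ) ≠ 0 := by exact_mod_cast hn.ne'
    rw [integral_div, h.integral_displacement_mul hs ht.le, mul_div_mul_left _ _ hn']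
  rw [tendsto_nhds_unique hlim hconst, div_mul_cancel₀ _ ht.ne']

/-- The mean displacement in time `t` is exactly linear in `t`, and it is `t ∫ Q + O(t ^ 2)`, so its
slope can be read off as `t` tends to zero. -/
theorem integral_stripRotation_eq_integral_velocity (h : IsStripFlow K F P Q Φ)
    (hs : HasSymmetricHessian K P Q) :
    ∫ z, stripRotation Φ z ∂stripMeasure = ∫ z, Q z ∂stripMeasure := by
  rw [← sub_eq_zero]
  have hle : ∀ n : ℕ, |∫ z, stripRotation Φ z ∂stripMeasure - ∫ z, Q z ∂stripMeasure| ≤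
      K * K * (1 / ((n : ℝ) + 1)) := by
    intro n
    set t : ℝ := 1 / ((n : ℝ) + 1) with ht
    have ht0 : 0 < t := by positivity
    have key := abs_integral_stripMeasure_sub_le
      (u := fun z => (Φ t z).1 - z.1) (v := fun z => t * Q z)
      ((continuous_fst.comp (h.continuous_map t)).sub continuous_fst)
      (continuous_const.mul h.lipschitz_s.continuous) (B := K * |t|) (B' := t * K)
      (fun z => by
        have := h.dist_time_le z t 0
        rw [h.map_zero, sub_zero, Strip.dist_eq] at this
        exact (le_max_left _ _).trans this)
      (fun z => by
        rw [abs_mul, abs_of_pos ht0]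
        exact mul_le_mul_of_nonneg_left (h.abs_s_le z) ht0.le)
      (fun z => h.abs_fst_sub_le z ht0.le)
    rw [← h.integral_stripRotation_mul hs ht0, integral_const_mul, mul_comm t, ← sub_mul, abs_mul,
      abs_of_pos ht0, sq, ← mul_assoc] at key
    exact le_of_mul_le_mul_right key ht0
  have hlim := (tendsto_one_div_add_atTop_nhds_zero_nat (𝕜 := ℝ)).const_mul ((K : ℝ) * K)
  rw [mul_zero] at hlim
  exact abs_nonpos_iff.1 (ge_of_tendsto' hlim hle)

end IsStripFlow

theorem IsStripGradient.hasDerivAt_vertical {K : NNReal} {F P Q : Strip → ℝ}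
    (g : IsStripGradient K F P Q) (θ : ℝ) {s : ℝ} (hs : s ∈ Ioo (0 : ℝ) 1) :
    HasDerivAt (fun s => F (toStrip (θ, s))) (Q (toStrip (θ, s))) s := by
  rw [hasDerivAt_iff_isLittleO]
  refine Asymptotics.IsBigO.trans_isLittleO (g := fun u => |u - s| ^ 2) ?_ ?_
  · refine Asymptotics.IsBigO.of_bound K ?_
    filter_upwards [Ioo_mem_nhds hs.1 hs.2] with u hu
    have ht := g.taylor (toStrip (θ, s)) (toStrip (θ, s)) (toStrip (θ, u))
    rw [dist_self, add_zero, toStrip_snd (x := (θ, s)) (Ioo_subset_Icc_self hs),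
      toStrip_snd (x := (θ, u)) (Ioo_subset_Icc_self hu)] at ht
    have hd : dist (toStrip (θ, u)) (toStrip (θ, s)) ≤ |u - s| := by
      refine (dist_toStrip_le _ _).trans (le_of_eq ?_)
      rw [Prod.dist_eq, dist_self, max_eq_right dist_nonneg, Real.dist_eq]
    have e : (toStrip (θ, u)).1 - (toStrip (θ, s)).1 = 0 := sub_self _
    rw [e, mul_zero, sub_zero] at ht
    rw [smul_eq_mul, Real.norm_eq_abs, Real.norm_eq_abs, abs_pow, abs_abs, mul_comm (u - s)]
    refine ht.trans ?_
    rw [mul_assoc, ← sq]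
    exact mul_le_mul_of_nonneg_left (pow_le_pow_left₀ dist_nonneg hd 2) K.2
  · refine (Asymptotics.isLittleO_pow_sub_sub s (m := 2) one_lt_two).congr_left fun u => ?_
    simp

/-- The mean of the velocity in the direction of `θ`. -/
theorem IsStripGradient.integral_velocity {K : NNReal} {F P Q : Strip → ℝ}
    (g : IsStripGradient K F P Q) {a b : ℝ} (ha : ∀ θ, F (θ, 0) = a) (hb : ∀ θ, F (θ, 1) = b) :
    ∫ z, Q z ∂stripMeasure = b - a := by
  have hQc := g.lipschitz_s.continuous
  rw [integral_stripMeasure hQc, stripBox, Measure.volume_eq_prod,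
    setIntegral_prod _ (by
      refine Measure.integrableOn_of_bounded (M := K) ?_
        (hQc.comp continuous_toStrip).aestronglyMeasurable
        (Eventually.of_forall fun x => g.abs_s_le _)
      rw [Measure.prod_prod]
      simp)]
  -- The fundamental theorem of calculus on each vertical segment.
  have hinner : ∀ θ : ℝ, ∫ s in Ioo (0 : ℝ) 1, Q (toStrip (θ, s)) = b - a := by
    intro θ
    have hF : Continuous fun s => F (toStrip (θ, s)) := by
      have hFc : Continuous F := by
        refine continuous_iff_continuousAt.2 fun z => ?_
        rw [ContinuousAt, tendsto_iff_dist_tendsto_zero]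
        have hlim : Tendsto (fun w : Strip => K * dist w z * dist w z + K * |w.1 - z.1| +
            K * |(w.2 : ℝ) - z.2|) (𝓝 z) (𝓝 0) := by
          have : Continuous (fun w : Strip => (K : ℝ) * dist w z * dist w z + K * |w.1 - z.1| +
            K * |(w.2 : ℝ) - z.2|) := by fun_prop
          simpa using this.tendsto z
        refine squeeze_zero (fun _ => dist_nonneg) (fun w => ?_) hlim
        have ht := g.taylor z z w
        rw [dist_self, add_zero] at ht
        have h1 : |P z * (w.1 - z.1)| ≤ K * |w.1 - z.1| := by
          rw [abs_mul]
          exact mul_le_mul_of_nonneg_right (g.abs_theta_le z) (abs_nonneg _)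
        have h2 : |Q z * ((w.2 : ℝ) - z.2)| ≤ K * |(w.2 : ℝ) - z.2| := by
          rw [abs_mul]
          exact mul_le_mul_of_nonneg_right (g.abs_s_le z) (abs_nonneg _)
        rw [Real.dist_eq]
        have e : F w - F z = (F w - F z - P z * (w.1 - z.1) - Q z * ((w.2 : ℝ) - z.2)) +
          P z * (w.1 - z.1) + Q z * ((w.2 : ℝ) - z.2) := by ring
        rw [e]
        refine (abs_add_three _ _ _).trans ?_
        linarith
      exact hFc.comp (continuous_toStrip.comp (by fun_prop))
    have := intervalIntegral.integral_eq_sub_of_hasDerivAt_of_le zero_le_one hF.continuousOn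
      (fun s hs => g.hasDerivAt_vertical θ hs)
      ((hQc.comp (continuous_toStrip.comp (by fun_prop : Continuous fun s : ℝ => (θ, s))
        )).intervalIntegrable 0 1)
    rw [intervalIntegral.integral_of_le zero_le_one, integral_Ioc_eq_integral_Ioo] at this
    refine this.trans ?_
    rw [← ha θ, ← hb θ]
    congr 2 <;> simp [toStrip, projIcc_left, projIcc_right]
  simp only [hinner]
  simp

/-! ### Autonomous flows on the annulus and loops of fixed points -/

theorem SmoothOnAnnulus.smoothFamily {F : Annulus → ℝ} (hF : SmoothOnAnnulus F) :
    SmoothFamilyOnAnnulus fun _ => F :=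
  ContDiffOn.comp (t := univ ×ˢ Icc 0 1) (f := fun p : ℝ × ℝ × ℝ => p.2) hF
    contDiff_snd.contDiffOn fun _ hp => hp.2

/-- Symmetry of the second derivative makes the two mixed entries equal; the bounds are the
Lipschitz constants of `P` and `Q`. In the open strip the one-sided `∂F/∂s` is an ordinary
derivative. -/
theorem SmoothOnAnnulus.hasSymmetricHessian {K : NNReal} {F : Annulus → ℝ}
    (hF : SmoothOnAnnulus F) (hP : LipschitzWith K (partialTheta F))
    (hQ : LipschitzWith K (partialS F)) :
    HasSymmetricHessian K (partialTheta F) (partialS F) := by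
  intro x hx
  set G : ℝ × ℝ → ℝ := fun p => inCoords F p.1 p.2 with hG
  have hU : ∀ᶠ y : ℝ × ℝ in 𝓝 x, y.2 ∈ Ioo (0 : ℝ) 1 :=
    continuous_snd.continuousAt.eventually (Ioo_mem_nhds hx.1 hx.2)
  have hsm : ∀ y : ℝ × ℝ, y.2 ∈ Ioo (0 : ℝ) 1 → ContDiffAt ℝ ∞ G y := fun y hy =>
    ContDiffOn.contDiffAt hF (prod_mem_nhds univ_mem (Icc_mem_nhds hy.1 hy.2))
  have hd : ∀ y : ℝ × ℝ, y.2 ∈ Ioo (0 : ℝ) 1 → HasFDerivAt G (fderiv ℝ G y) y := fun y hy =>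
    ((hsm y hy).differentiableAt (by simp)).hasFDerivAt
  have eP : ∀ y : ℝ × ℝ, y.2 ∈ Ioo (0 : ℝ) 1 →
      partialTheta F (toStrip y) = fderiv ℝ G y (1, 0) := fun y hy => by
    have h1 : HasDerivAt (fun θ : ℝ => ((θ, y.2) : ℝ × ℝ)) (1, 0) y.1 :=
      (hasDerivAt_id _).prodMk (hasDerivAt_const _ _)
    have h2 := ((hd y hy).comp_hasDerivAt y.1 h1).deriv
    rw [← h2, partialTheta, toStrip_snd (Ioo_subset_Icc_self hy)]
    rfl
  have eQ : ∀ y : ℝ × ℝ, y.2 ∈ Ioo (0 : ℝ) 1 →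
      partialS F (toStrip y) = fderiv ℝ G y (0, 1) := fun y hy => by
    have h1 : HasDerivAt (fun s : ℝ => ((y.1, s) : ℝ × ℝ)) (0, 1) y.2 :=
      (hasDerivAt_const _ _).prodMk (hasDerivAt_id _)
    have h2 := ((hd y hy).comp_hasDerivAt y.2 h1).deriv
    rw [← h2, partialS, toStrip_snd (Ioo_subset_Icc_self hy),
      derivWithin_of_mem_nhds (Icc_mem_nhds hy.1 hy.2)]
    rfl
  have hsymm : IsSymmSndFDerivAt ℝ G x := (hsm x hx).isSymmSndFDerivAt (by
    rw [minSmoothness_of_isRCLikeNormedField]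
    exact WithTop.coe_le_coe.2 le_top)
  have hD : HasFDerivAt (fderiv ℝ G) (fderiv ℝ (fderiv ℝ G) x) x :=
    (((hsm x hx).fderiv_right (m := ∞) (by simp)).differentiableAt (by simp)).hasFDerivAt
  set D := fderiv ℝ (fderiv ℝ G) x with hDdef
  have hdir : ∀ v : ℝ × ℝ, HasFDerivAt (fun y => fderiv ℝ G y v)
      (D (1, 0) v • ContinuousLinearMap.fst ℝ ℝ ℝ + D (0, 1) v • ContinuousLinearMap.snd ℝ ℝ ℝ)
      x := fun v => by
    refine (hD.clm_apply (hasFDerivAt_const v x)).congr_fderiv ?_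
    ext <;> simp
  have hQd : HasFDerivAt (fun y => partialS F (toStrip y)) _ x :=
    (hdir (0, 1)).congr_of_eventuallyEq (hU.mono eQ)
  have hPd : HasFDerivAt (fun y => partialTheta F (toStrip y)) _ x :=
    (hdir (1, 0)).congr_of_eventuallyEq (hU.mono eP)
  have hbound : ∀ {R : Strip → ℝ} {L : ℝ × ℝ →L[ℝ] ℝ}, LipschitzWith K R →
      HasFDerivAt (fun y => R (toStrip y)) L x → ∀ v : ℝ × ℝ, ‖v‖ ≤ 1 → |L v| ≤ K := by
    intro R L hR hL v hv
    have hlip : LipschitzWith K (fun y => R (toStrip y)) := LipschitzWith.of_dist_le_mul fun y z =>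
      (hR.dist_le_mul _ _).trans (mul_le_mul_of_nonneg_left (dist_toStrip_le y z) K.2)
    exact (L.le_opNorm v).trans ((mul_le_of_le_one_right (norm_nonneg _) hv).trans
      (hL.le_of_lipschitz hlip))
  have hv1 : ‖((1, 0) : ℝ × ℝ)‖ ≤ 1 := by simp [Prod.norm_def]
  have hv2 : ‖((0, 1) : ℝ × ℝ)‖ ≤ 1 := by simp [Prod.norm_def]
  refine ⟨D (1, 0) (0, 1), D (0, 1) (0, 1), D (1, 0) (1, 0), ?_, ?_, ?_, hQd, ?_⟩
  · simpa using hbound hQ hQd _ hv1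
  · simpa using hbound hQ hQd _ hv2
  · simpa using hbound hP hPd _ hv1
  · rw [show D (1, 0) (0, 1) = D (0, 1) (1, 0) from hsymm _ _]
    exact hPd

/-- The lift to the strip of an autonomous flow that is tangent to the boundary. -/
theorem IsAutonomousFlow.exists_isStripFlow {F : Annulus → ℝ} {φ : ℝ → Annulus → Annulus}
    (h : IsAutonomousFlow F φ) :
    ∃ K Φ, IsStripFlow K (F ∘ annulusCover) (partialTheta F) (partialS F) Φ ∧
      HasSymmetricHessian K (partialTheta F) (partialS F) ∧
      ∀ t z, annulusCover (Φ t z) = φ t (annulusCover z) := by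
  obtain ⟨hF, hb, hφ⟩ := h
  obtain ⟨K, hK⟩ := hF.smoothFamily.exists_isStripGradient fun _ _ => hb
  have hg := hK 0 (left_mem_Icc.2 zero_le_one)
  choose γ hγ h0 hγφ using hφ.exists_lift (mem_univ 0)
  exact ⟨K, fun t z => γ z t, ⟨hg, h0, hγ⟩,
    hF.hasSymmetricHessian hg.lipschitz_theta hg.lipschitz_s, fun t z => hγφ z t (mem_univ t)⟩

/-- A trajectory that goes around the annulus in time `T`, where `1 / |T|` is an integer, is a loop
of fixed points that meets the radial arc. -/
theorem IsStripFlow.exists_loop {K : NNReal} {F P Q : Strip → ℝ} {Φ : ℝ → Strip → Strip}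
    (h : IsStripFlow K F P Q Φ) {φ : ℝ → Annulus → Annulus}
    (hφ : ∀ t z, annulusCover (Φ t z) = φ t (annulusCover z)) {T : ℝ} {z : Strip} (hT : T ≠ 0)
    (hz : Φ T z = z.shift 1) {n : ℕ} (hn : 1 / |T| = n) :
    ∃ c, IsLoopOfFixedPoints φ c ∧ (c ∩ radialArc).Nonempty := by
  have hz' : Φ T z = z.shift ((1 : ℤ) : ℝ) := by rw [hz, Int.cast_one]
  refine ⟨range fun t => φ t (annulusCover z), ⟨annulusCover z, |T|, rfl, abs_pos.2 hT, ?_, ?_,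
    n, hn⟩, ?_⟩
  · have habs : ∃ k : ℤ, |T| = k * T := by
      rcases abs_choice T with e | e
      · exact ⟨1, by rw [e, Int.cast_one, one_mul]⟩
      · exact ⟨-1, by rw [e, Int.cast_neg, Int.cast_one, neg_one_mul]⟩
    obtain ⟨k, hk⟩ := habs
    rw [← hφ, hk, h.map_mul hz', annulusCover_shift]
  · intro t ht htT hper
    rw [← hφ] at hper
    obtain ⟨m, hm⟩ := exists_shift_of_annulusCover_eq hper
    -- A return at time `t` with translation `m` has the same rotation number, `m / t = 1 / T`.
    -- Since this is nonzero, `|m| ≥ 1` and `t = |m| |T| ≥ |T|`.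
    have e := (h.stripRotation_eq ht.ne' hm).symm.trans (h.stripRotation_eq_one_div hT hz)
    rw [div_eq_div_iff ht.ne' hT, one_mul] at e
    have hm0 : m ≠ 0 := by
      rintro rfl
      rw [Int.cast_zero, zero_mul] at e
      exact ht.ne e
    have hm1 : (1 : ℝ) ≤ |(m : ℝ)| := by
      rw [← Int.cast_abs]
      exact_mod_cast Int.one_le_abs hm0
    have : |T| ≤ t := by
      rw [← abs_of_pos ht, ← e, abs_mul]
      exact le_mul_of_one_le_left (abs_nonneg _) hm1
    exact absurd htT (not_lt.2 this)
  · have hc : Continuous fun t => (Φ t z).1 := continuous_fst.comp (h.continuous_time z)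
    -- During one turn `θ` passes through every value from `z.1` to `z.1 + 1`, among them an
    -- integer, that is a point over `L`.
    have hmem : (⌈z.1⌉ : ℝ) ∈ uIcc (Φ 0 z).1 (Φ T z).1 := by
      rw [h.map_zero, hz, Strip.shift_fst, uIcc_of_le (by linarith)]
      exact ⟨Int.le_ceil _, (Int.ceil_lt_add_one _).le⟩
    obtain ⟨t, -, ht⟩ := intermediate_value_uIcc hc.continuousOn hmem
    refine ⟨φ t (annulusCover z), mem_range_self t, ?_⟩
    change (φ t (annulusCover z)).1 = 0
    rw [← hφ]
    change (((Φ t z).1 : ℝ) : UnitAddCircle) = 0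
    rw [show (Φ t z).1 = (⌈z.1⌉ : ℝ) from ht, AddCircle.coe_eq_zero_iff]
    exact ⟨⌈z.1⌉, by simp⟩

theorem hamiltonianFlux_const (F : Annulus → ℝ) :
    hamiltonianFlux (fun _ => F) = F (0, 1) - F (0, 0) := by
  simp [hamiltonianFlux]

theorem IsAutonomousFlow.integral_stripRotation {F : Annulus → ℝ} {φ : ℝ → Annulus → Annulus}
    (h : IsAutonomousFlow F φ) {K : NNReal} {Φ : ℝ → Strip → Strip}
    (hΦ : IsStripFlow K (F ∘ annulusCover) (partialTheta F) (partialS F) Φ)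
    (hs : HasSymmetricHessian K (partialTheta F) (partialS F)) :
    ∫ z, stripRotation Φ z ∂stripMeasure = F (0, 1) - F (0, 0) := by
  rw [hΦ.integral_stripRotation_eq_integral_velocity hs]
  exact hΦ.toIsStripGradient.integral_velocity (fun θ => (h.2.1 θ).1) fun θ => (h.2.1 θ).2

/-- Maps in `Ham'(A)` with flux larger than one have the fixed loop property. -/
theorem fixedLoopProperty_radialArc :
    FixedLoopProperty radialArc {g | g ∈ HamStationary ∧ 1 < fluxL g} := by
  rintro g ⟨⟨H, hH⟩, hflux⟩ F φ hF rfl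
  rw [hH.fluxL_eq] at hflux
  obtain ⟨hb, γ, hγ, h0, hγg, hγc, hγ0⟩ := hH.exists_lift
  obtain ⟨K, Φ, hΦ, hs, hφ⟩ := hF.exists_isStripFlow
  -- The map `g` fixes the boundary because it is generated by `H`, even though the flow of `F` may
  -- rotate it.
  have hfix : annulusCover (Φ 1 (0, 0)) = annulusCover (0, 0) := by
    rw [hφ, ← hγg, hγ0]
  obtain ⟨k, hk⟩ := exists_shift_of_annulusCover_eq hfix
  have hrot : stripRotation Φ (0, 0) = k := by
    rw [hΦ.stripRotation_eq one_ne_zero hk, div_one]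
  rcases eq_or_ne k 0 with rfl | hk0
  · rw [Int.cast_zero] at hk hrot
    rw [Strip.shift_zero] at hk
    have hlift : (fun z => γ z 1) = Φ 1 :=
      eq_of_annulusCover_eq hγc (hΦ.continuous_map 1) (fun z => (hγg z).trans (hφ 1 z).symm) (0, 0)
        (hγ0.trans hk.symm)
    have hfl : hamiltonianFlux H = hamiltonianFlux fun _ => F :=
      hamiltonianFlux_eq_of_lifts hH.1 hF.1.smoothFamily hb (fun _ _ => hF.2.1) hγ
        (γ' := fun z t => Φ t z) (fun z => (hΦ.solution z).mono (subset_univ _)) h0 hΦ.map_zero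
        (congrFun hlift)
    rw [hfl, hamiltonianFlux_const, ← hF.integral_stripRotation hΦ hs] at hflux
    -- Otherwise the mean of the rotation number, which is the flux, would be at most 1.
    have hex : ∃ z, 1 ≤ stripRotation Φ z := by
      by_contra! hlt
      have := integral_mono (μ := stripMeasure) (g := fun _ => (1 : ℝ))
        (Integrable.of_bound hΦ.continuous_stripRotation.aestronglyMeasurable K
          (Eventually.of_forall hΦ.abs_stripRotation_le)) (integrable_const _)
        fun z => (hlt z).le
      rw [integral_const, measureReal_def, measure_univ, ENNReal.toReal_one, one_smul] at this
      exact absurd hflux (not_lt.2 this)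
    obtain ⟨w, hw⟩ := mem_range_of_exists_le_of_exists_ge hΦ.continuous_stripRotation
      ⟨(0, 0), hrot.trans_le zero_le_one⟩ hex
    rcases hΦ.stripRotation_eq_zero_or w with hw0 | ⟨T, hT, hTw, hTr⟩
    · exact absurd (hw.symm.trans hw0) one_ne_zero
    · refine hΦ.exists_loop hφ hT hTw (n := 1) ?_
      rw [hw] at hTr
      rw [← abs_one_div, ← hTr, abs_one, Nat.cast_one]
  -- The boundary point itself has rotation number `k = 1 / T`, so its trajectory is a loop with `1
  -- / |T| = |k|`.
  · rcases hΦ.stripRotation_eq_zero_or (0, 0) with hw0 | ⟨T, hT, hTw, hTr⟩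
    · exact absurd (hrot.symm.trans hw0) (Int.cast_ne_zero.2 hk0)
    · refine hΦ.exists_loop hφ hT hTw (n := k.natAbs) ?_
      rw [← abs_one_div, ← hTr, hrot, Nat.cast_natAbs, Int.cast_abs]

/-! ### The rotation number as a function on the annulus -/

theorem surjective_annulusCover : Function.Surjective annulusCover := fun x => by
  obtain ⟨θ, hθ⟩ := QuotientAddGroup.mk_surjective x.1
  exact ⟨(θ, x.2), Prod.ext hθ rfl⟩

theorem isQuotientMap_annulusCover : IsQuotientMap annulusCover :=
  (IsOpenQuotientMap.prodMap QuotientAddGroup.isOpenQuotientMap_mk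
    IsOpenQuotientMap.id).isQuotientMap

theorem measurePreserving_annulusCover : MeasurePreserving annulusCover stripMeasure volume := by
  have h1 := UnitAddCircle.measurePreserving_mk 0
  rw [zero_add] at h1
  exact h1.prod (MeasurePreserving.id volume)

theorem IsStationaryAutonomousFlow.generatesStationary {F : Annulus → ℝ}
    {φ : ℝ → Annulus → Annulus} (h : IsStationaryAutonomousFlow F φ) :
    GeneratesStationary (fun _ => F) (φ 1) := by
  obtain ⟨⟨hF, hb, h0, hφ⟩, ε, hε, hc⟩ := h
  refine ⟨hF.smoothFamily, ⟨ε, hε, fun _ _ => hc⟩, φ, ⟨h0, fun x => ?_⟩, rfl⟩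
  obtain ⟨γ, hγ, hγφ⟩ := hφ x
  exact ⟨γ, hγ.isStripSolution.mono (subset_univ _), fun t _ => hγφ t (mem_univ t)⟩

/-- The limit may be taken along integer times, at which the flow is an iterate of its time-one map.
-/
theorem stripRotation_eq_of_map_one_eq {K K' : NNReal} {F F' P P' Q Q' : Strip → ℝ}
    {Φ Φ' : ℝ → Strip → Strip} (h : IsStripFlow K F P Q Φ) (h' : IsStripFlow K' F' P' Q' Φ')
    (h1 : Φ 1 = Φ' 1) (z : Strip) : stripRotation Φ z = stripRotation Φ' z := by
  have hn : ∀ n : ℕ, Φ n z = Φ' n z := fun n => by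
    induction n with
    | zero => rw [Nat.cast_zero, h.map_zero, h'.map_zero]
    | succ n ih => rw [Nat.cast_succ, add_comm, h.map_add, h'.map_add, ih, h1]
  have e := (h.tendsto_stripRotation z).comp tendsto_natCast_atTop_atTop
  have e' := (h'.tendsto_stripRotation z).comp tendsto_natCast_atTop_atTop
  refine tendsto_nhds_unique e (e'.congr fun n => ?_)
  simp only [Function.comp_apply, hn]

/-- The lift of a flow that is stationary near the boundary is stationary there. -/
theorem IsStripFlow.map_eq_self_of_constOnCollars {K : NNReal} {F : Annulus → ℝ}
    {Φ : ℝ → Strip → Strip}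
    (h : IsStripFlow K (F ∘ annulusCover) (partialTheta F) (partialS F) Φ) {ε : ℝ}
    (hc : ConstOnCollars ε F) {z : Strip} (hz : (z.2 : ℝ) < ε ∨ 1 - ε < (z.2 : ℝ)) (t : ℝ) :
    Φ t z = z :=
  h.map_eq_self_of_critical (partialTheta_eq_zero_of_constOnCollars hc hz)
    (partialS_eq_zero_of_constOnCollars hc hz) t

/-- The rotation numbers of an autonomous map, and their mean. -/
theorem exists_rotation_function (g : Annulus → Annulus)
    (hg : ∃ (F : Annulus → ℝ) (φ : ℝ → Annulus → Annulus),
      IsStationaryAutonomousFlow F φ ∧ φ 1 = g) :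
    ∃ r : Annulus → ℝ,
      (∀ (F : Annulus → ℝ) (φ : ℝ → Annulus → Annulus),
        IsStationaryAutonomousFlow F φ → φ 1 = g → ∀ x, HasRotationNumber φ x (r x)) ∧
      Continuous r ∧
      (∃ ε > 0, ∀ x : Annulus, ((x.2 : ℝ) < ε ∨ 1 - ε < (x.2 : ℝ)) → r x = 0) ∧
      fluxL g = ∫ x, r x := by
  obtain ⟨F, φ, hF, rfl⟩ := hg
  obtain ⟨K, Φ, hΦ, hs, hφ⟩ := hF.1.exists_isStripFlow
  obtain ⟨ε, hε, hc⟩ := hF.2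
  -- The choice of the lift does not matter, by invariance under integer shifts.
  set r : Annulus → ℝ := fun x => stripRotation Φ (Function.surjInv surjective_annulusCover x)
    with hr
  have hrz : ∀ z, r (annulusCover z) = stripRotation Φ z := fun z => by
    obtain ⟨n, hn⟩ := exists_shift_of_annulusCover_eq
      (Function.surjInv_eq surjective_annulusCover (annulusCover z))
    simp only [hr]
    rw [hn, hΦ.stripRotation_shift]
  have hcont : Continuous r := by
    rw [isQuotientMap_annulusCover.continuous_iff]
    exact hΦ.continuous_stripRotation.congr fun z => (hrz z).symm
  refine ⟨r, fun F' φ' hF' h1 x => ?_, hcont, ⟨ε, hε, fun x hx => ?_⟩, ?_⟩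
  · obtain ⟨K', Φ', hΦ', -, hφ'⟩ := hF'.1.exists_isStripFlow
    obtain ⟨ε', hε', hc'⟩ := hF'.2
    obtain ⟨z, rfl⟩ := surjective_annulusCover x
    -- Both flows are stationary near the boundary, so both lifts of `g` fix `(0, 0)`.
    have hone : Φ 1 = Φ' 1 := by
      refine eq_of_annulusCover_eq (hΦ.continuous_map 1) (hΦ'.continuous_map 1)
        (fun z => by rw [hφ, hφ', h1]) (0, 0) ?_
      rw [hΦ.map_eq_self_of_constOnCollars hc (by simp [hε]),
        hΦ'.map_eq_self_of_constOnCollars hc' (by simp [hε'])]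
    refine ⟨fun t => (Φ' t z).1, continuous_fst.comp (hΦ'.continuous_time z), fun t => ?_, ?_⟩
    · exact congrArg Prod.fst (hφ' t z)
    · rw [hrz, stripRotation_eq_of_map_one_eq hΦ hΦ' hone]
      beta_reduce
      rw [hΦ'.map_zero]
      exact hΦ'.tendsto_stripRotation z
  · obtain ⟨z, rfl⟩ := surjective_annulusCover x
    rw [hrz, hΦ.stripRotation_eq (m := 0) one_ne_zero
      (by rw [hΦ.map_eq_self_of_constOnCollars hc hx, Int.cast_zero, Strip.shift_zero]),
      Int.cast_zero, zero_div]
  · rw [hF.generatesStationary.fluxL_eq, hamiltonianFlux_const,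
      ← hF.1.integral_stripRotation hΦ hs, ← measurePreserving_annulusCover.map_eq,
      integral_map measurePreserving_annulusCover.measurable.aemeasurable
        hcont.aestronglyMeasurable]
    simp only [hrz]

theorem mainTheorem4 :
    -- the flux does not depend on the Hamiltonian that generates the map
    (∀ (g : Annulus → Annulus) (H : ℝ → Annulus → ℝ), GeneratesStationary H g →
      fluxL g = hamiltonianFlux H) ∧
    -- rotation numbers of autonomous maps, and the flux identity
    (∀ g : Annulus → Annulus,
      (∃ (F : Annulus → ℝ) (φ : ℝ → Annulus → Annulus),
        IsStationaryAutonomousFlow F φ ∧ φ 1 = g) →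
      ∃ r : Annulus → ℝ,
        (∀ (F : Annulus → ℝ) (φ : ℝ → Annulus → Annulus),
          IsStationaryAutonomousFlow F φ → φ 1 = g → ∀ x, HasRotationNumber φ x (r x)) ∧
        Continuous r ∧
        (∃ ε > 0, ∀ x : Annulus, ((x.2 : ℝ) < ε ∨ 1 - ε < (x.2 : ℝ)) → r x = 0) ∧
        fluxL g = ∫ x, r x) ∧
    -- the fixed loop property
    FixedLoopProperty radialArc {g | g ∈ HamStationary ∧ 1 < fluxL g} :=
  ⟨fun _ _ h => h.fluxL_eq, exists_rotation_function, fixedLoopProperty_radialArc⟩
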